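/- **Theorem.** For each $n$ let $K=K_n\in\mathbb N$ and $0\le q=q_n\le p=p_n\le 1$. Let $C^*=C^*_n\subset[n]$ be a (deterministic or random) set and, given $C^*$, let $G=G_n$ be the random graph on $[n]$ in which distinct pairs of vertices are joined independently, with probability $p$ if both endpoints lie in $C^*$ and with probability $q$ otherwise. Assume that, as $n\to\infty$, $p/q=O(1)$, $n^{1-o(1)}\le K\le o(n)$, that $$\lambda=\frac{K^2(p-q)^2}{(n-K)q}$$ is a constant with $\lambda>1$, that $(np)^{\log (n/K)}=n^{o(1)}$, and that $$\mathbb P\Big\{\big||C^*|-K\big|\ge\sqrt{3K\log n}\Big\}\le n^{-1/2+o(1)} .$$ Let $m=(n-K)q$, let $A_0=1$, $A_t=0$ for $t\ge1$, $B_t=\lambda^{t/2}$ for $t\ge0$, and let $\partial i$ be the set of neighbors of $i$ in $G$. Put $\theta^0_{i\to j}=1$ for all $i\in[n]$, $j\in\partial i$, and for $t\ge0$ $$\theta^{t+1}_{i\to j}=-\frac{q((n-K)A_t+KB_t)}{\sqrt m}+\frac1{\sqrt m}\sum_{\ell\in\partial i\setminus\{j\}}\theta^t_{\ell\to i},\qquad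 \theta^{t+1}_{u}=-\frac{q((n-K)A_t+KB_t)}{\sqrt m}+\frac1{\sqrt m}\sum_{i\in\partial u}\theta^t_{i\to u}.$$ Let $T=\Big\lceil \frac12\,\frac{\log\frac{n-K}{K}}{\log\lambda}\Big\rceil$ and let $\hat C$ be the set of the $K$ indices $i\in[n]$ with the largest values of $\theta_i^T$ (ties broken arbitrarily). Then $\mathbb E\,|C^*\triangle\hat C|=o(K)$ as $n\to\infty$. -/

import Mathlib

open Filter Topology MeasureTheory Asymptotics

noncomputable section

namespace PDS

/-- The connection probability of two distinct vertices `i`, `j` when the community is `S`. -/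
def edgeProb {n : ℕ} (p q : ℝ) (S : Finset (Fin n)) (i j : Fin n) : ℝ :=
  if i ∈ S ∧ j ∈ S then p else q

open Classical in
/-- The probability that the random graph equals `H` when the community is `S`: every unordered
pair of distinct vertices (listed as `i < j`) is joined, independently of the others, with
probability `edgeProb p q S i j`. -/
def graphProb {n : ℕ} (p q : ℝ) (S : Finset (Fin n)) (H : SimpleGraph (Fin n)) : ℝ :=
  ∏ e ∈ (Finset.univ : Finset (Fin n × Fin n)).filter (fun e => e.1 < e.2),
    if H.Adj e.1 e.2 then edgeProb p q S e.1 e.2 else 1 - edgeProb p q S e.1 e.2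

/-- `(C, G)`, defined on the probability space `(Ω, μ)`, is a planted dense subgraph model on the
vertex set `Fin n`: the community `C` is a random set with an arbitrary law (possibly
deterministic), and given `C` the edges of `G` are independent, a pair of vertices being joined
with probability `p` if both vertices are in `C` and with probability `q` otherwise. -/
structure IsPlantedDenseSubgraph {n : ℕ} {Ω : Type*} [MeasurableSpace Ω] (μ : Measure Ω)
    (p q : ℝ) (C : Ω → Finset (Fin n)) (G : Ω → SimpleGraph (Fin n)) : Prop where
  measurable_community : ∀ S : Finset (Fin n), MeasurableSet {ω | C ω = S}
  measurable_graph : ∀ H : SimpleGraph (Fin n), MeasurableSet {ω | G ω = H}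
  law : ∀ (S : Finset (Fin n)) (H : SimpleGraph (Fin n)),
    μ.real {ω | C ω = S ∧ G ω = H} = μ.real {ω | C ω = S} * graphProb p q S H

/-- The effective signal-to-noise ratio `λ = K² (p - q)² / ((n - K) q)`. -/
def snr (n K : ℕ) (p q : ℝ) : ℝ :=
  (K : ℝ) ^ 2 * (p - q) ^ 2 / (((n : ℝ) - K) * q)

/-- The scaling parameter `m = (n - K) q`. -/
def scale (n K : ℕ) (q : ℝ) : ℝ := ((n : ℝ) - K) * q

/-- `A_0 = 1` and `A_t = 0` for `t ≥ 1`. -/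
def meanOutside (t : ℕ) : ℝ := if t = 0 then 1 else 0

/-- `B_t = λ ^ (t / 2)`. -/
def meanInside (n K : ℕ) (p q : ℝ) (t : ℕ) : ℝ := snr n K p q ^ ((t : ℝ) / 2)

/-- The centring term `- q ((n - K) A_t + K B_t) / √m`. -/
def centring (n K : ℕ) (p q : ℝ) (t : ℕ) : ℝ :=
  -(q * (((n : ℝ) - K) * meanOutside t + K * meanInside n K p q t)) / √(scale n K q)

open Classical in
/-- The message `θ^t_{i → j}` of linear (non-backtracking) message passing on `G`. It is
meaningful, and used, only for pairs `i`, `j` that are adjacent in `G`. -/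
def message {n : ℕ} (K : ℕ) (p q : ℝ) (G : SimpleGraph (Fin n)) : ℕ → Fin n → Fin n → ℝ
  | 0, _, _ => 1
  | t + 1, i, j => centring n K p q t + 1 / √(scale n K q) *
      ∑ l ∈ Finset.univ.filter (fun l => G.Adj i l ∧ l ≠ j), message K p q G t l i

open Classical in
/-- The belief `θ_u^{t+1}` of the vertex `u`, computed from the messages `θ^t`. -/
def beliefSucc {n : ℕ} (K : ℕ) (p q : ℝ) (G : SimpleGraph (Fin n)) (t : ℕ) (u : Fin n) : ℝ :=
  centring n K p q t + 1 / √(scale n K q) *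
    ∑ i ∈ Finset.univ.filter (fun i => G.Adj u i), message K p q G t i u

/-- The number of iterations `T = ⌈2 α log ((n - K) / K) / log λ⌉` with `α = 1 / 4`. -/
def numIter (n K : ℕ) (p q : ℝ) : ℕ :=
  ⌈2 * (1 / 4 : ℝ) * (Real.log (((n : ℝ) - K) / K) / Real.log (snr n K p q))⌉₊

/-- `S` consists of `K` indices with the largest values of `f` (ties broken in any way). -/
def IsTopSet {n : ℕ} (K : ℕ) (f : Fin n → ℝ) (S : Finset (Fin n)) : Prop :=
  S.card = K ∧ ∀ i ∈ S, ∀ j ∉ S, f j ≤ f i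

/-- `S` is a possible output of the algorithm run on the graph `G`: `T - 1` iterations of message
passing, one more iteration to compute the beliefs `θ_i^T`, and selection of the `K` vertices with
the largest beliefs. -/
def IsLMPOutput {n : ℕ} (K : ℕ) (p q : ℝ) (G : SimpleGraph (Fin n)) (S : Finset (Fin n)) : Prop :=
  IsTopSet K (beliefSucc K p q G (numIter n K p q - 1)) S

end PDS

end

/-! Condition on the community being a set `S` whose size is within √(3K log n) of K, and write x =
n/K. While the breadth-first exploration from a vertex meets a forest, the non-backtracking
recursion sees each vertex once, and the belief becomes an explicit linear functional of the level
sizes (`beliefSucc_eq_levelSum`). Its exponential moments, restricted to the forest event, are at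
most those of a branching process whose labels are drawn with replacement, up to a factor (1 -
p)^(-N²) per level, where N is the budget of explored vertices (`bernExp_exp_levelSum_le`).
Revealing edges level by level and applying Markov's inequality shows that the forest event fails
with polynomially small probability (`bernExp_not_isTreeExploration_le`).

For the branching process, the centring makes the mean A_t outside and B_t inside the community when
|S| = K. `branchingMGF_le` carries a mean, a mean error and a variance proxy through the recursion.
The mean error comes from |S| - K and stays negligible. The variance proxy stays at most 8: the only
increment of order x^(-1/2) is the second moment of the community's contribution, and there are
O(log x) levels. This balance uses B_T² ≤ λ√x. Hence the exponential moment at s = ±1 is at most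
exp(s · mean + 9).

Since B_T is at least (x/2)^(1/4), a Chernoff bound at threshold B_T/2 misclassifies a vertex with
probability at most 2 exp(9 - B_T/2) plus the failure probability (`misclassification_le`,
`typical_misclassification_le`). Multiplied by n = Kx this is o(K). Selecting the K largest beliefs
instead of thresholding at most doubles the error and adds ||S| - K| (`IsTopSet.card_symmDiff_le`).
Atypical sizes contribute at most n · n^(-1/2+o(1)), which is also o(K). -/

noncomputable section

namespace PDS

/-! ### Expectations over independent Bernoulli subsets -/

section BernExp

variable {α : Type*} [DecidableEq α]

/-- The expectation of `f E`, where `E` is the random subset of `P` that contains each `e ∈ P`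
independently with probability `w e`. -/
def bernExp (w : α → ℝ) (P : Finset α) (f : Finset α → ℝ) : ℝ :=
  ∑ E ∈ P.powerset, (∏ e ∈ E, w e) * (∏ e ∈ P \ E, (1 - w e)) * f E

variable {w : α → ℝ} {P Q : Finset α} {f g : Finset α → ℝ}

theorem bernExp_congr (h : ∀ E ⊆ P, f E = g E) : bernExp w P f = bernExp w P g :=
  Finset.sum_congr rfl fun E hE => by rw [h E (Finset.mem_powerset.1 hE)]

theorem bernExp_mono (hw0 : ∀ e, 0 ≤ w e) (hw1 : ∀ e, w e ≤ 1) (h : ∀ E ⊆ P, f E ≤ g E) :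
    bernExp w P f ≤ bernExp w P g :=
  Finset.sum_le_sum fun E hE => mul_le_mul_of_nonneg_left (h E (Finset.mem_powerset.1 hE))
    (mul_nonneg (Finset.prod_nonneg fun e _ => hw0 e)
      (Finset.prod_nonneg fun e _ => sub_nonneg.2 (hw1 e)))

theorem bernExp_add (f g : Finset α → ℝ) :
    bernExp w P (fun E => f E + g E) = bernExp w P f + bernExp w P g := by
  simp [bernExp, mul_add, Finset.sum_add_distrib]

theorem bernExp_sum {ι : Type*} (s : Finset ι) (f : ι → Finset α → ℝ) :
    bernExp w P (fun E => ∑ i ∈ s, f i E) = ∑ i ∈ s, bernExp w P (f i) := by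
  simp only [bernExp, Finset.mul_sum]
  rw [Finset.sum_comm]

theorem bernExp_const_mul (c : ℝ) (f : Finset α → ℝ) :
    bernExp w P (fun E => c * f E) = c * bernExp w P f := by
  simp only [bernExp, Finset.mul_sum]
  exact Finset.sum_congr rfl fun E _ => by ring

/-- The expectation of a product over the random set. -/
theorem bernExp_prod (g : α → ℝ) :
    bernExp w P (fun E => ∏ e ∈ E, g e) = ∏ e ∈ P, (1 - w e + w e * g e) := by
  have : ∀ e, 1 - w e + w e * g e = w e * g e + (1 - w e) := fun e => by ring
  simp only [this, Finset.prod_add, bernExp]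
  refine Finset.sum_congr rfl fun E _ => ?_
  rw [Finset.prod_mul_distrib]
  ring

theorem bernExp_const (c : ℝ) : bernExp w P (fun _ => c) = c := by
  have h := bernExp_prod (w := w) (P := P) (fun _ => 1)
  have h2 := bernExp_const_mul (w := w) (P := P) c (fun _ => 1)
  simp only [Finset.prod_const_one, mul_one, sub_add_cancel] at h h2
  rw [h2, h, mul_one]

theorem bernExp_insert {a : α} (ha : a ∉ P) (f : Finset α → ℝ) :
    bernExp w (insert a P) f =
      (1 - w a) * bernExp w P f + w a * bernExp w P (fun E => f (insert a E)) := by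
  simp only [bernExp, Finset.mul_sum]
  rw [Finset.sum_powerset_insert ha]
  congr 1
  · refine Finset.sum_congr rfl fun E hE => ?_
    have haE : a ∉ E := fun h => ha (Finset.mem_powerset.1 hE h)
    rw [Finset.insert_sdiff_of_notMem _ haE, Finset.prod_insert (by simp [ha])]
    ring
  · refine Finset.sum_congr rfl fun E hE => ?_
    have haE : a ∉ E := fun h => ha (Finset.mem_powerset.1 hE h)
    rw [Finset.insert_sdiff_insert, Finset.sdiff_insert_of_notMem ha, Finset.prod_insert haE]
    ring

/-- Independence of disjoint blocks of coordinates, in Fubini form; this is what permits revealing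
the graph in stages. -/
theorem bernExp_union (h : Disjoint P Q) (f : Finset α → ℝ) :
    bernExp w (P ∪ Q) f = bernExp w P (fun E => bernExp w Q (fun E' => f (E ∪ E'))) := by
  induction P using Finset.induction_on generalizing f with
  | empty => simp [bernExp]
  | insert a P ha ih =>
    have hd := Finset.disjoint_insert_left.1 h
    rw [Finset.insert_union, bernExp_insert (by simp [ha, hd.1]), bernExp_insert ha, ih hd.2,
      ih hd.2]
    simp only [Finset.insert_union]

/-- The probability that all elements of a given set are present. -/
theorem bernExp_subset {F : Finset α} (hF : F ⊆ P) :
    bernExp w P (fun E => if F ⊆ E then 1 else 0) = ∏ e ∈ F, w e := by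
  have h1 : bernExp w P (fun E => if F ⊆ E then (1 : ℝ) else 0) =
      bernExp w (F ∪ (P \ F)) (fun E => if F ⊆ E then (1 : ℝ) else 0) := by
    rw [Finset.union_sdiff_of_subset hF]
  rw [h1, bernExp_union Finset.disjoint_sdiff]
  rw [bernExp_congr (g := fun E => if F ⊆ E then (1 : ℝ) else 0)]
  · rw [bernExp, Finset.sum_eq_single F]
    · simp
    · intro E hE hne
      rw [if_neg, mul_zero]
      exact fun h => hne (Finset.Subset.antisymm (Finset.mem_powerset.1 hE) h)
    · simp
  · intro E hE
    rw [bernExp_congr (g := fun _ => if F ⊆ E then (1 : ℝ) else 0), bernExp_const]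
    intro E' hE'
    have : F ⊆ E ∪ E' ↔ F ⊆ E := by
      refine ⟨fun h e he => ?_, fun h => h.trans Finset.subset_union_left⟩
      rcases Finset.mem_union.1 (h he) with h' | h'
      · exact h'
      · exact absurd he (Finset.mem_sdiff.1 (hE' h')).2
    simp only [this]

theorem bernExp_mem_le (hw0 : ∀ e, 0 ≤ w e) (e : α) :
    bernExp w P (fun E => if e ∈ E then 1 else 0) ≤ w e := by
  by_cases he : e ∈ P
  · have := bernExp_subset (w := w) (Finset.singleton_subset_iff.2 he)
    simp only [Finset.singleton_subset_iff, Finset.prod_singleton] at this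
    exact this.le
  · rw [bernExp_congr (g := fun _ => 0), bernExp_const]
    · exact hw0 e
    · intro E hE
      rw [if_neg fun h => he (hE h)]

theorem bernExp_mem_mem_le (hw0 : ∀ e, 0 ≤ w e) {e e' : α} (hne : e ≠ e') :
    bernExp w P (fun E => if e ∈ E ∧ e' ∈ E then 1 else 0) ≤ w e * w e' := by
  by_cases he : e ∈ P ∧ e' ∈ P
  · have := bernExp_subset (w := w) (P := P) (F := {e, e'})
      (Finset.insert_subset he.1 (Finset.singleton_subset_iff.2 he.2))
    simp only [Finset.insert_subset_iff, Finset.singleton_subset_iff, Finset.prod_pair hne] at this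
    exact this.le
  · rw [bernExp_congr (g := fun _ => 0), bernExp_const]
    · exact mul_nonneg (hw0 e) (hw0 e')
    · intro E hE
      rw [if_neg fun h => he ⟨hE h.1, hE h.2⟩]

end BernExp

/-! ### Breadth-first exploration and its branching process -/

section Exploration

variable {V : Type*} [DecidableEq V]

/-- The unordered pairs of distinct elements of `U`. -/
def pairs (U : Finset V) : Finset (Sym2 V) := U.sym2.filter (fun e => ¬ e.IsDiag)

theorem mk_mem_pairs {U : Finset V} {a b : V} : s(a, b) ∈ pairs U ↔ (a ∈ U ∧ b ∈ U) ∧ a ≠ b := by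
  simp [pairs]

theorem pairs_mono {U U' : Finset V} (h : U ⊆ U') : pairs U ⊆ pairs U' := by
  intro e
  induction e with
  | _ a b =>
    rw [mk_mem_pairs, mk_mem_pairs]
    exact fun ⟨⟨ha, hb⟩, hab⟩ => ⟨⟨h ha, h hb⟩, hab⟩

/-- The vertices of `U` outside `A` that have a neighbour in `A`, in the graph with edges `E`. -/
def nextLevel (E : Finset (Sym2 V)) (U A : Finset V) : Finset V :=
  (U \ A).filter (fun l => ∃ a ∈ A, s(a, l) ∈ E)

/-- There is no edge inside `A`, and every vertex of `U` outside `A` has at most one neighbour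
in `A`. -/
def IsTreeStep (E : Finset (Sym2 V)) (U A : Finset V) : Prop :=
  (∀ a ∈ A, ∀ b ∈ A, s(a, b) ∉ E) ∧
    ∀ l ∈ U \ A, ∀ a ∈ A, ∀ b ∈ A, s(a, l) ∈ E → s(b, l) ∈ E → a = b

/-- The breadth-first exploration of depth `r`, started from the level `A` with the set `U`
of vertices that were not explored before (including `A`), meets a forest and at most `N`
vertices before the last level. -/
def IsTreeExploration [Fintype V] (N : ℕ) (E : Finset (Sym2 V)) :
    ℕ → Finset V → Finset V → Prop
  | 0, _, _ => True
  | r + 1, U, A => Uᶜ.card + A.card ≤ N ∧ IsTreeStep E U A ∧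
      IsTreeExploration N E r (U \ A) (nextLevel E U A)

/-- The linear functional of the level sizes to which linear message passing reduces on trees. -/
def levelSum (c : ℕ → ℝ) (R : ℝ) (E : Finset (Sym2 V)) : ℕ → Finset V → Finset V → ℝ
  | 0, _, A => A.card
  | r + 1, U, A => c r * A.card + 1 / R * levelSum c R E r (U \ A) (nextLevel E U A)

/-- The exponential moment at `s` of the belief of depth `r` at a vertex of the branching process
whose individuals are labelled by `V`, an individual labelled `i` having a child labelled `l`
with probability `w s(i, l)`. -/
def branchingMGF [Fintype V] (w : Sym2 V → ℝ) (c : ℕ → ℝ) (R : ℝ) : ℕ → ℝ → V → ℝ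
  | 0, s, _ => Real.exp s
  | r + 1, s, i => Real.exp (s * c r) *
      ∏ l, (1 - w s(i, l) + w s(i, l) * branchingMGF w c R r (s / R) l)

variable {E E' : Finset (Sym2 V)} {U A : Finset V}

theorem mem_nextLevel {l : V} :
    l ∈ nextLevel E U A ↔ l ∈ U \ A ∧ ∃ a ∈ A, s(a, l) ∈ E := Finset.mem_filter

theorem nextLevel_subset : nextLevel E U A ⊆ U \ A := Finset.filter_subset _ _

theorem nextLevel_congr (hA : A ⊆ U) (h : ∀ a ∈ U, ∀ b ∈ U, s(a, b) ∈ E ↔ s(a, b) ∈ E') :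
    nextLevel E U A = nextLevel E' U A := by
  refine Finset.filter_congr fun l hl => ?_
  have hlU := (Finset.mem_sdiff.1 hl).1
  exact exists_congr fun a => and_congr_right fun ha => h a (hA ha) l hlU

theorem isTreeStep_congr (hA : A ⊆ U) (h : ∀ a ∈ A, ∀ b ∈ U, s(a, b) ∈ E ↔ s(a, b) ∈ E') :
    IsTreeStep E U A ↔ IsTreeStep E' U A := by
  refine and_congr ?_ ?_
  · exact forall₂_congr fun a ha => forall₂_congr fun b hb => not_congr (h a ha b (hA hb))
  · refine forall₂_congr fun l hl => forall₂_congr fun a ha => forall₂_congr fun b hb => ?_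
    have hlU := (Finset.mem_sdiff.1 hl).1
    rw [h a ha l hlU, h b hb l hlU]

theorem isTreeExploration_congr [Fintype V] {N : ℕ} (r : ℕ) :
    ∀ {U A : Finset V}, A ⊆ U → (∀ a ∈ U, ∀ b ∈ U, s(a, b) ∈ E ↔ s(a, b) ∈ E') →
      (IsTreeExploration N E r U A ↔ IsTreeExploration N E' r U A) := by
  induction r with
  | zero => intros; rfl
  | succ r ih =>
    intro U A hA h
    simp only [IsTreeExploration]
    rw [isTreeStep_congr hA fun a ha b hb => h a (hA ha) b hb, nextLevel_congr hA h,
      ih nextLevel_subset fun a ha b hb =>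
        h a (Finset.sdiff_subset ha) b (Finset.sdiff_subset hb)]

theorem levelSum_congr {c : ℕ → ℝ} {R : ℝ} (r : ℕ) :
    ∀ {U A : Finset V}, A ⊆ U → (∀ a ∈ U, ∀ b ∈ U, s(a, b) ∈ E ↔ s(a, b) ∈ E') →
      levelSum c R E r U A = levelSum c R E' r U A := by
  induction r with
  | zero => intros; rfl
  | succ r ih =>
    intro U A hA h
    simp only [levelSum]
    rw [nextLevel_congr hA h, ih nextLevel_subset fun a ha b hb =>
        h a (Finset.sdiff_subset ha) b (Finset.sdiff_subset hb)]

/-- One stage of exploration: the edges meeting `A` are revealed first, and those inside `U \ A`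
remain fresh for the deeper levels. -/
theorem bernExp_pairs_split {w : Sym2 V → ℝ} (U A : Finset V) (f : Finset (Sym2 V) → ℝ) :
    bernExp w (pairs U) f = bernExp w (pairs U \ pairs (U \ A)) (fun E =>
      bernExp w (pairs (U \ A)) (fun E' => f (E ∪ E'))) := by
  rw [← bernExp_union Finset.sdiff_disjoint,
    Finset.sdiff_union_of_subset (pairs_mono Finset.sdiff_subset)]

theorem mk_mem_union_left {a b : V} (ha : a ∈ A) (hE' : E' ⊆ pairs (U \ A)) :
    s(a, b) ∈ E ∪ E' ↔ s(a, b) ∈ E := by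
  rw [Finset.mem_union, or_iff_left]
  intro h
  have := (mk_mem_pairs.1 (hE' h)).1.1
  exact (Finset.mem_sdiff.1 this).2 ha

theorem mk_mem_union_right {a b : V} (ha : a ∈ U \ A) (hb : b ∈ U \ A)
    (hE : E ⊆ pairs U \ pairs (U \ A)) : s(a, b) ∈ E ∪ E' ↔ s(a, b) ∈ E' := by
  rw [Finset.mem_union, or_iff_right]
  intro h
  have h2 := Finset.mem_sdiff.1 (hE h)
  exact h2.2 (mk_mem_pairs.2 ⟨⟨ha, hb⟩, (mk_mem_pairs.1 h2.1).2⟩)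

theorem nextLevel_union (hE' : E' ⊆ pairs (U \ A)) :
    nextLevel (E ∪ E') U A = nextLevel E U A :=
  Finset.filter_congr fun _ _ => exists_congr fun _ => and_congr_right fun ha =>
    mk_mem_union_left ha hE'

/-! ### Comparison of exploration and branching, and the probability of failure -/

section

variable {N : ℕ} {w : Sym2 V → ℝ} {c : ℕ → ℝ} {R π : ℝ}

theorem isTreeExploration_succ_union [Fintype V] {r : ℕ} (hA : A ⊆ U)
    (hE : E ⊆ pairs U \ pairs (U \ A)) (hE' : E' ⊆ pairs (U \ A)) :
    IsTreeExploration N (E ∪ E') (r + 1) U A ↔ (Uᶜ.card + A.card ≤ N ∧ IsTreeStep E U A) ∧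
      IsTreeExploration N E' r (U \ A) (nextLevel E U A) := by
  rw [IsTreeExploration, nextLevel_union hE', and_assoc,
    isTreeStep_congr hA fun a ha b _ => mk_mem_union_left ha hE',
    isTreeExploration_congr r nextLevel_subset fun a ha b hb => mk_mem_union_right ha hb hE]

theorem levelSum_succ_union {r : ℕ} (hE : E ⊆ pairs U \ pairs (U \ A))
    (hE' : E' ⊆ pairs (U \ A)) :
    levelSum c R (E ∪ E') (r + 1) U A =
      c r * A.card + 1 / R * levelSum c R E' r (U \ A) (nextLevel E U A) := by
  rw [levelSum, nextLevel_union hE',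
    levelSum_congr r nextLevel_subset fun a ha b hb => mk_mem_union_right ha hb hE]

omit [DecidableEq V] in
theorem branchingMGF_nonneg [Fintype V] (hw0 : ∀ e, 0 ≤ w e) (hw1 : ∀ e, w e ≤ 1) (r : ℕ) :
    ∀ s i, 0 ≤ branchingMGF w c R r s i := by
  induction r with
  | zero => exact fun s _ => (Real.exp_pos s).le
  | succ r ih =>
    intro s i
    refine mul_nonneg (Real.exp_pos _).le (Finset.prod_nonneg fun l _ => ?_)
    exact add_nonneg (sub_nonneg.2 (hw1 _)) (mul_nonneg (hw0 _) (ih _ _))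

/-- Along a tree step, a product over the next level is a product over the edges to it. -/
theorem prod_nextLevel_eq (g : V → ℝ) (hE : E ⊆ pairs U \ pairs (U \ A))
    (h : IsTreeStep E U A) :
    ∏ l ∈ nextLevel E U A, g l = ∏ e ∈ E, ∏ l ∈ (U \ A).filter (fun l => l ∈ e), g l := by
  simp only [Finset.prod_filter, nextLevel]
  rw [Finset.prod_comm]
  refine Finset.prod_congr rfl fun l hl => ?_
  split_ifs with hex
  · obtain ⟨a, ha, hal⟩ := hex
    rw [Finset.prod_eq_single s(a, l)]
    · simp
    · intro e he hne
      rw [if_neg]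
      rintro ⟨b, rfl⟩
      have hbU : b ∈ U := by
        have := (mk_mem_pairs.1 (Finset.mem_sdiff.1 (hE he)).1).1.2
        exact this
      have hbA : b ∈ A := by
        by_contra hb
        have h2 := Finset.mem_sdiff.1 (hE he)
        exact h2.2 (mk_mem_pairs.2 ⟨⟨hl, Finset.mem_sdiff.2 ⟨hbU, hb⟩⟩, (mk_mem_pairs.1 h2.1).2⟩)
      rw [Sym2.eq_swap] at he
      have := h.2 l hl a ha b hbA hal he
      subst this
      exact hne Sym2.eq_swap
    · exact fun h => absurd hal h
  · symm
    refine Finset.prod_eq_one fun e he => ?_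
    rw [if_neg]
    rintro ⟨b, rfl⟩
    have hbU : b ∈ U := (mk_mem_pairs.1 (Finset.mem_sdiff.1 (hE he)).1).1.2
    have hbA : b ∈ A := by
      by_contra hb
      have h2 := Finset.mem_sdiff.1 (hE he)
      exact h2.2 (mk_mem_pairs.2 ⟨⟨hl, Finset.mem_sdiff.2 ⟨hbU, hb⟩⟩, (mk_mem_pairs.1 h2.1).2⟩)
    exact hex ⟨b, hbA, by rwa [Sym2.eq_swap]⟩

/-- A product over all pairs that meet `A`, the factors of the pairs inside `A` being one. -/
theorem prod_pairs_meeting (hA : A ⊆ U) (w : Sym2 V → ℝ) (g : V → ℝ) :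
    ∏ e ∈ pairs U \ pairs (U \ A),
        (1 - w e + w e * ∏ l ∈ (U \ A).filter (fun l => l ∈ e), g l) =
      ∏ a ∈ A, ∏ l ∈ U \ A, (1 - w s(a, l) + w s(a, l) * g l) := by
  rw [← Finset.prod_product']
  symm
  rw [← Finset.prod_subset (s₁ := (A ×ˢ (U \ A)).image (fun x => s(x.1, x.2)))]
  · rw [Finset.prod_image]
    · refine Finset.prod_congr rfl fun x hx => ?_
      obtain ⟨hx1, hx2⟩ := Finset.mem_product.1 hx
      have : (U \ A).filter (fun l => l ∈ s(x.1, x.2)) = {x.2} := by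
        ext l
        simp only [Finset.mem_filter, Sym2.mem_iff, Finset.mem_singleton]
        constructor
        · rintro ⟨hl, rfl | rfl⟩
          · exact absurd hx1 (Finset.mem_sdiff.1 hl).2
          · rfl
        · rintro rfl
          exact ⟨hx2, Or.inr rfl⟩
      rw [this, Finset.prod_singleton]
    · intro x hx y hy hxy
      obtain ⟨hx1, hx2⟩ := Finset.mem_product.1 hx
      obtain ⟨hy1, hy2⟩ := Finset.mem_product.1 hy
      rcases Sym2.eq_iff.1 hxy with ⟨h1, h2⟩ | ⟨h1, h2⟩
      · exact Prod.ext h1 h2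
      · exact absurd (h1 ▸ hx1) (Finset.mem_sdiff.1 hy2).2
  · intro e he
    obtain ⟨x, hx, rfl⟩ := Finset.mem_image.1 he
    obtain ⟨hx1, hx2⟩ := Finset.mem_product.1 hx
    obtain ⟨hx3, hx4⟩ := Finset.mem_sdiff.1 hx2
    rw [Finset.mem_sdiff, mk_mem_pairs, mk_mem_pairs]
    exact ⟨⟨⟨hA hx1, hx3⟩, fun h => hx4 (h ▸ hx1)⟩, fun h => (Finset.mem_sdiff.1 h.1.1).2 hx1⟩
  · intro e he hne
    rw [Finset.prod_eq_one]
    · ring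
    · intro l hl
      exfalso
      obtain ⟨hl1, b, rfl⟩ := Finset.mem_filter.1 hl
      obtain ⟨h1, h2⟩ := Finset.mem_sdiff.1 he
      rw [mk_mem_pairs] at h1 h2
      refine hne (Finset.mem_image.2 ⟨(b, l), Finset.mem_product.2 ⟨?_, hl1⟩, Sym2.eq_swap⟩)
      by_contra hb
      exact h2 ⟨⟨hl1, Finset.mem_sdiff.2 ⟨h1.1.2, hb⟩⟩, h1.2⟩

theorem card_compl_sdiff [Fintype V] (hA : A ⊆ U) : (U \ A)ᶜ.card = Uᶜ.card + A.card := by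
  rw [← Finset.card_union_of_disjoint]
  · congr 1
    ext v
    simp only [Finset.mem_compl, Finset.mem_sdiff, Finset.mem_union]
    tauto
  · rw [Finset.disjoint_left]
    exact fun v hv hvA => (Finset.mem_compl.1 hv) (hA hvA)

/-- Cost of replacement: each of the at most N active vertices gains at most N extra labels, and
every added factor is at least 1 - π. -/
theorem prod_sdiff_le [Fintype V] (hw0 : ∀ e, 0 ≤ w e) (hwπ : ∀ e, w e ≤ π) (hπ0 : 0 ≤ π)
    (hπ : π < 1) {g : V → ℝ} (hg : ∀ l, 0 ≤ g l) (hA : A ⊆ U) (hN : Uᶜ.card + A.card ≤ N) :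
    ∏ a ∈ A, ∏ l ∈ U \ A, (1 - w s(a, l) + w s(a, l) * g l) ≤
      ((1 - π) ^ (N ^ 2))⁻¹ * ∏ a ∈ A, ∏ l, (1 - w s(a, l) + w s(a, l) * g l) := by
  have hpos : 0 < 1 - π := by linarith
  have hF : ∀ a l, 1 - π ≤ 1 - w s(a, l) + w s(a, l) * g l := fun a l => by
    have := mul_nonneg (hw0 s(a, l)) (hg l)
    linarith [hwπ s(a, l)]
  have hF0 : ∀ a l, 0 ≤ 1 - w s(a, l) + w s(a, l) * g l := fun a l => hpos.le.trans (hF a l)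
  have h1 : ∀ a ∈ A, ∏ l ∈ U \ A, (1 - w s(a, l) + w s(a, l) * g l) ≤
      ((1 - π) ^ N)⁻¹ * ∏ l, (1 - w s(a, l) + w s(a, l) * g l) := by
    intro a _
    rw [le_inv_mul_iff₀ (pow_pos hpos _), ← Finset.prod_mul_prod_compl (U \ A), mul_comm]
    refine mul_le_mul_of_nonneg_left ?_ (Finset.prod_nonneg fun l _ => hF0 a l)
    calc (1 - π) ^ N ≤ (1 - π) ^ (U \ A)ᶜ.card :=
          pow_le_pow_of_le_one hpos.le (by linarith) (by rwa [card_compl_sdiff hA])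
      _ = ∏ l ∈ (U \ A)ᶜ, (1 - π) := by rw [Finset.prod_const]
      _ ≤ _ := Finset.prod_le_prod (fun _ _ => hpos.le) fun l _ => hF a l
  calc _ ≤ ∏ a ∈ A, (((1 - π) ^ N)⁻¹ * ∏ l, (1 - w s(a, l) + w s(a, l) * g l)) :=
        Finset.prod_le_prod (fun a _ => Finset.prod_nonneg fun l _ => hF0 a l) h1
    _ ≤ _ := by
        rw [Finset.prod_mul_distrib, Finset.prod_const]
        refine mul_le_mul_of_nonneg_right ?_
          (Finset.prod_nonneg fun a _ => Finset.prod_nonneg fun l _ => hF0 a l)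
        rw [pow_two, pow_mul, ← inv_pow ((1 - π) ^ N)]
        exact pow_le_pow_right₀ ((one_le_inv₀ (pow_pos hpos _)).2
          (pow_le_one₀ hpos.le (by linarith))) (by omega)

open Classical in
/-- On exploration of a forest, the exponential moments of the level sums are at most those of the
branching process, up to a factor that accounts for sampling without replacement. -/
theorem bernExp_exp_levelSum_le [Fintype V] (hw0 : ∀ e, 0 ≤ w e) (hwπ : ∀ e, w e ≤ π)
    (hπ0 : 0 ≤ π) (hπ : π < 1) (r : ℕ) : ∀ (s : ℝ) (U A : Finset V), A ⊆ U →
    bernExp w (pairs U) (fun E => if IsTreeExploration N E r U A then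
        Real.exp (s * levelSum c R E r U A) else 0) ≤
      ((1 - π) ^ (N ^ 2))⁻¹ ^ r * ∏ i ∈ A, branchingMGF w c R r s i := by
  have hw1 : ∀ e, w e ≤ 1 := fun e => (hwπ e).trans hπ.le
  have hpos : 0 < 1 - π := by linarith
  induction r with
  | zero =>
    intro s U A _
    rw [bernExp_congr (g := fun _ => Real.exp (s * A.card)), bernExp_const]
    · simp only [branchingMGF, pow_zero, one_mul, Finset.prod_const, ← Real.exp_nat_mul]
      rw [mul_comm]
    · exact fun E _ => if_pos trivial
  | succ r ih =>
    intro s U A hA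
    set κ := ((1 - π) ^ (N ^ 2))⁻¹ with hκ
    have hκ0 : 0 ≤ κ := inv_nonneg.2 (pow_nonneg hpos.le _)
    by_cases hN : Uᶜ.card + A.card ≤ N
    · rw [bernExp_pairs_split U A]
      -- Given the edges `E` that meet `A`, the induction hypothesis bounds the rest by a product
      -- over the next level. On a tree step this is a product over the edges of `E`, which
      -- `bernExp_prod` then integrates exactly; without a tree step the left side vanishes.
      calc _ ≤ bernExp w (pairs U \ pairs (U \ A)) (fun E =>
              (Real.exp (s * c r * A.card) * κ ^ r) * ∏ e ∈ E, ∏ l ∈ (U \ A).filter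
                (fun l => l ∈ e), branchingMGF w c R r (s / R) l) := by
            refine bernExp_mono hw0 hw1 fun E hE => ?_
            by_cases hT : IsTreeStep E U A
            · rw [← prod_nextLevel_eq _ hE hT, mul_assoc]
              refine le_trans (le_of_eq ?_) (mul_le_mul_of_nonneg_left
                (ih (s / R) (U \ A) (nextLevel E U A) nextLevel_subset) (Real.exp_pos _).le)
              rw [← bernExp_const_mul]
              refine bernExp_congr fun E' hE' => ?_
              rw [isTreeExploration_succ_union hA hE hE', levelSum_succ_union hE hE']
              simp only [hN, hT, and_self, true_and]
              split_ifs
              · rw [← Real.exp_add]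
                congr 1
                ring
              · rw [mul_zero]
            · rw [bernExp_congr (g := fun _ => 0), bernExp_const]
              · exact mul_nonneg (mul_nonneg (Real.exp_pos _).le (pow_nonneg hκ0 _))
                  (Finset.prod_nonneg fun _ _ => Finset.prod_nonneg fun _ _ =>
                    branchingMGF_nonneg hw0 hw1 _ _ _)
              · intro E' hE'
                rw [isTreeExploration_succ_union hA hE hE', if_neg]
                exact fun h => hT h.1.2
        _ = Real.exp (s * c r * A.card) * κ ^ r * ∏ a ∈ A, ∏ l ∈ U \ A, (1 - w s(a, l) +
              w s(a, l) * branchingMGF w c R r (s / R) l) := by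
            rw [bernExp_const_mul, bernExp_prod, prod_pairs_meeting hA]
        _ ≤ Real.exp (s * c r * A.card) * κ ^ r * (κ * ∏ a ∈ A, ∏ l, (1 - w s(a, l) +
              w s(a, l) * branchingMGF w c R r (s / R) l)) := by
            refine mul_le_mul_of_nonneg_left ?_ (mul_nonneg (Real.exp_pos _).le
              (pow_nonneg hκ0 _))
            exact prod_sdiff_le hw0 hwπ hπ0 hπ (branchingMGF_nonneg hw0 hw1 _ _) hA hN
        _ = _ := by
            simp only [branchingMGF]
            rw [Finset.prod_mul_distrib, Finset.prod_const, ← Real.exp_nat_mul,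
              mul_comm (A.card : ℝ)]
            ring
    · rw [bernExp_congr (g := fun _ => 0), bernExp_const]
      · exact mul_nonneg (pow_nonneg hκ0 _) (Finset.prod_nonneg fun _ _ =>
          branchingMGF_nonneg hw0 hw1 _ _ _)
      · intro E _
        rw [IsTreeExploration, if_neg]
        exact fun h => hN h.1

-- Union bound over the at most N² pairs inside `A`, and over the vertices outside together with two
-- distinct neighbours in `A`.
open Classical in
theorem bernExp_not_isTreeStep_le [Fintype V] (hw0 : ∀ e, 0 ≤ w e) (hwπ : ∀ e, w e ≤ π)
    (hπ0 : 0 ≤ π) (hπ : π ≤ 1) (P : Finset (Sym2 V)) (hN : A.card ≤ N) :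
    bernExp w P (fun E => if IsTreeStep E U A then 0 else 1) ≤
      N ^ 2 * π + Fintype.card V * N ^ 2 * π ^ 2 := by
  have hw1 : ∀ e, w e ≤ 1 := fun e => (hwπ e).trans hπ
  have hN' : (A.card : ℝ) ≤ N := Nat.cast_le.2 hN
  have hsq : (A.card : ℝ) ^ 2 ≤ (N : ℝ) ^ 2 := pow_le_pow_left₀ (Nat.cast_nonneg _) hN' 2
  have hnn1 : ∀ (E : Finset (Sym2 V)) (e : Sym2 V), (0 : ℝ) ≤ if e ∈ E then 1 else 0 :=
    fun E e => by split_ifs <;> norm_num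
  have hnn2 : ∀ (E : Finset (Sym2 V)) (e e' : Sym2 V),
      (0 : ℝ) ≤ if e ∈ E ∧ e' ∈ E then 1 else 0 := fun E e e' => by split_ifs <;> norm_num
  calc _ ≤ bernExp w P (fun E => (∑ a ∈ A, ∑ b ∈ A, if s(a, b) ∈ E then (1 : ℝ) else 0) +
          ∑ l ∈ U \ A, ∑ x ∈ A.offDiag, if s(x.1, l) ∈ E ∧ s(x.2, l) ∈ E then (1 : ℝ) else 0) := by
        refine bernExp_mono hw0 hw1 fun E _ => ?_
        have n1 : (0 : ℝ) ≤ ∑ a ∈ A, ∑ b ∈ A, if s(a, b) ∈ E then (1 : ℝ) else 0 :=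
          Finset.sum_nonneg fun _ _ => Finset.sum_nonneg fun _ _ => hnn1 _ _
        have n2 : (0 : ℝ) ≤ ∑ l ∈ U \ A, ∑ x ∈ A.offDiag,
            if s(x.1, l) ∈ E ∧ s(x.2, l) ∈ E then (1 : ℝ) else 0 :=
          Finset.sum_nonneg fun _ _ => Finset.sum_nonneg fun _ _ => hnn2 _ _ _
        split_ifs with h
        · exact add_nonneg n1 n2
        · rw [IsTreeStep, not_and_or] at h
          rcases h with h | h
          · push Not at h
            obtain ⟨a, ha, b, hb, hab⟩ := h
            have := Finset.single_le_sum (fun b _ => hnn1 E s(a, b)) hb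
            have h2 := Finset.single_le_sum (f := fun a => ∑ b ∈ A, if s(a, b) ∈ E then (1 : ℝ)
              else 0) (fun a _ => Finset.sum_nonneg fun b _ => hnn1 E s(a, b)) ha
            rw [if_pos hab] at this
            linarith
          · push Not at h
            obtain ⟨l, hl, a, ha, b, hb, hal, hbl, hab⟩ := h
            have := Finset.single_le_sum (f := fun x : V × V =>
              if s(x.1, l) ∈ E ∧ s(x.2, l) ∈ E then (1 : ℝ) else 0)
              (fun x _ => hnn2 E s(x.1, l) s(x.2, l))
              (show (a, b) ∈ A.offDiag from Finset.mem_offDiag.2 ⟨ha, hb, hab⟩)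
            have h2 := Finset.single_le_sum (f := fun l => ∑ x ∈ A.offDiag,
              if s(x.1, l) ∈ E ∧ s(x.2, l) ∈ E then (1 : ℝ) else 0)
              (fun l _ => Finset.sum_nonneg fun x _ => hnn2 E s(x.1, l) s(x.2, l)) hl
            rw [if_pos ⟨hal, hbl⟩] at this
            linarith
    _ ≤ (∑ a ∈ A, ∑ b ∈ A, π) + ∑ l ∈ U \ A, ∑ x ∈ A.offDiag, π * π := by
        rw [bernExp_add, bernExp_sum, bernExp_sum]
        refine add_le_add (Finset.sum_le_sum fun a _ => ?_) (Finset.sum_le_sum fun l _ => ?_)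
        · rw [bernExp_sum]
          exact Finset.sum_le_sum fun b _ => (bernExp_mem_le hw0 _).trans (hwπ _)
        · rw [bernExp_sum]
          refine Finset.sum_le_sum fun x hx => (bernExp_mem_mem_le hw0 ?_).trans
            (mul_le_mul (hwπ _) (hwπ _) (hw0 _) hπ0)
          rw [Ne, Sym2.congr_left]
          exact (Finset.mem_offDiag.1 hx).2.2
    _ ≤ _ := by
        simp only [Finset.sum_const, nsmul_eq_mul]
        have h1 : ((U \ A).card : ℝ) ≤ Fintype.card V := Nat.cast_le.2 (Finset.card_le_univ _)
        have h2 : (A.offDiag.card : ℝ) ≤ (A.card : ℝ) ^ 2 := by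
          rw [Finset.offDiag_card, ← Nat.cast_pow, Nat.cast_le, pow_two]
          exact Nat.sub_le _ _
        have h3 := h2.trans hsq
        refine add_le_add ?_ ?_
        · rw [← mul_assoc, ← pow_two]
          exact mul_le_mul_of_nonneg_right hsq hπ0
        · rw [← mul_assoc, ← pow_two]
          refine mul_le_mul_of_nonneg_right ?_ (by positivity)
          exact mul_le_mul h1 h3 (Nat.cast_nonneg _) (Nat.cast_nonneg _)

theorem bernExp_card_nextLevel_le [Fintype V] (hw0 : ∀ e, 0 ≤ w e) (hwπ : ∀ e, w e ≤ π)
    (hπ0 : 0 ≤ π) (hπ : π ≤ 1) (P : Finset (Sym2 V)) :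
    bernExp w P (fun E => ((nextLevel E U A).card : ℝ)) ≤ A.card * (Fintype.card V * π) := by
  have hw1 : ∀ e, w e ≤ 1 := fun e => (hwπ e).trans hπ
  have hnn1 : ∀ (E : Finset (Sym2 V)) (e : Sym2 V), (0 : ℝ) ≤ if e ∈ E then 1 else 0 :=
    fun E e => by split_ifs <;> norm_num
  calc _ ≤ bernExp w P (fun E => ∑ l ∈ U \ A, ∑ a ∈ A, if s(a, l) ∈ E then (1 : ℝ) else 0) := by
        refine bernExp_mono hw0 hw1 fun E _ => ?_
        rw [nextLevel, Finset.card_filter, Nat.cast_sum]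
        refine Finset.sum_le_sum fun l _ => ?_
        split_ifs with h
        · obtain ⟨a, ha, hal⟩ := h
          have := Finset.single_le_sum (fun a _ => hnn1 E s(a, l)) ha
          rw [if_pos hal] at this
          simpa using this
        · simp
    _ ≤ ∑ l ∈ U \ A, ∑ a ∈ A, π := by
        rw [bernExp_sum]
        refine Finset.sum_le_sum fun l _ => ?_
        rw [bernExp_sum]
        exact Finset.sum_le_sum fun a _ => (bernExp_mem_le hw0 _).trans (hwπ _)
    _ ≤ _ := by
        simp only [Finset.sum_const, nsmul_eq_mul]
        have h1 : ((U \ A).card : ℝ) ≤ Fintype.card V := Nat.cast_le.2 (Finset.card_le_univ _)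
        have := mul_le_mul_of_nonneg_right h1 (mul_nonneg (Nat.cast_nonneg A.card) hπ0)
        linarith

open Classical in
/-- The probability that the exploration meets a cycle or too many vertices. -/
theorem bernExp_not_isTreeExploration_le [Fintype V] (hw0 : ∀ e, 0 ≤ w e) (hwπ : ∀ e, w e ≤ π)
    (hπ0 : 0 ≤ π) (hπ : π ≤ 1) (hN0 : 0 < N) (r : ℕ) : ∀ (U A : Finset V), A ⊆ U →
    bernExp w (pairs U) (fun E => if IsTreeExploration N E r U A then 0 else 1) ≤
      r * (N ^ 2 * π + Fintype.card V * N ^ 2 * π ^ 2) +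
        (Uᶜ.card + A.card * ∑ t ∈ Finset.range (r + 1), (Fintype.card V * π) ^ t) / N := by
  have hw1 : ∀ e, w e ≤ 1 := fun e => (hwπ e).trans hπ
  have hN0' : (0 : ℝ) < N := Nat.cast_pos.2 hN0
  set η : ℝ := N ^ 2 * π + Fintype.card V * N ^ 2 * π ^ 2 with hη
  have hη0 : 0 ≤ η := by positivity
  set x : ℝ := Fintype.card V * π with hx
  have hx0 : 0 ≤ x := by positivity
  induction r with
  | zero =>
    intro U A _
    rw [bernExp_congr (g := fun _ => 0), bernExp_const]
    · positivity
    · exact fun E _ => if_pos trivial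
  | succ r ih =>
    intro U A hA
    have hg0 : 0 ≤ ∑ t ∈ Finset.range (r + 1), x ^ t :=
      Finset.sum_nonneg fun t _ => pow_nonneg hx0 t
    by_cases hN : Uᶜ.card + A.card ≤ N
    · rw [bernExp_pairs_split U A]
      -- The induction hypothesis is affine in the size of the next level, so only its mean, at most
      -- |A| · |V| π, is needed; this extends the geometric sum by one term.
      calc _ ≤ bernExp w (pairs U \ pairs (U \ A)) (fun E =>
              (if IsTreeStep E U A then 0 else 1) +
                ((r * η + (Uᶜ.card + A.card) / N) +
                (∑ t ∈ Finset.range (r + 1), x ^ t) / N * (nextLevel E U A).card)) := by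
            refine bernExp_mono hw0 hw1 fun E hE => ?_
            by_cases hT : IsTreeStep E U A
            · have := ih (U \ A) (nextLevel E U A) nextLevel_subset
              rw [card_compl_sdiff hA] at this
              rw [if_pos hT, zero_add]
              calc _ = bernExp w (pairs (U \ A)) (fun E' => if IsTreeExploration N E' r (U \ A)
                      (nextLevel E U A) then 0 else 1) := by
                    refine bernExp_congr fun E' hE' => ?_
                    rw [isTreeExploration_succ_union hA hE hE']
                    simp only [hN, hT, and_self, true_and]
                _ ≤ _ := this
                _ = _ := by push_cast; ring
            · rw [if_neg hT]
              calc _ ≤ bernExp w (pairs (U \ A)) (fun _ => 1) := by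
                    refine bernExp_mono hw0 hw1 fun E' _ => ?_
                    split_ifs <;> norm_num
                _ ≤ _ := by
                    rw [bernExp_const]
                    exact le_add_of_nonneg_right (by positivity)
        _ ≤ η + ((r * η + (Uᶜ.card + A.card) / N) +
                (∑ t ∈ Finset.range (r + 1), x ^ t) / N * (A.card * x)) := by
            rw [bernExp_add, bernExp_add, bernExp_const, bernExp_const_mul]
            refine add_le_add (bernExp_not_isTreeStep_le hw0 hwπ hπ0 hπ _ (by omega))
              (add_le_add le_rfl (mul_le_mul_of_nonneg_left ?_ (by positivity)))
            exact bernExp_card_nextLevel_le hw0 hwπ hπ0 hπ _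
        _ = _ := by
            rw [geom_sum_succ (n := r + 1)]
            push_cast
            ring
    · calc _ ≤ bernExp w (pairs U) (fun _ => 1) := by
            refine bernExp_mono hw0 hw1 fun E' _ => ?_
            split_ifs <;> norm_num
        -- Over budget, the Markov-type term alone is at least one, so the trivial bound suffices.
        _ ≤ ((Uᶜ.card + A.card * ∑ t ∈ Finset.range (r + 1 + 1), x ^ t) / N : ℝ) := by
            rw [bernExp_const, le_div_iff₀ hN0', one_mul, geom_sum_succ (n := r + 1)]
            have h1 : (N : ℝ) ≤ Uᶜ.card + A.card := by
              rw [← Nat.cast_add, Nat.cast_le]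
              omega
            have h2 : (0 : ℝ) ≤ A.card * (x * ∑ t ∈ Finset.range (r + 1), x ^ t) := by positivity
            linarith
        _ ≤ _ := le_add_of_nonneg_left (by positivity)

end

end Exploration

/-! ### The graph law as a Bernoulli set of unordered pairs -/

section GraphLaw

variable {n : ℕ} {p q : ℝ} {S : Finset (Fin n)}

/-- The connection probability of an unordered pair of vertices. -/
def edgeWeight (p q : ℝ) (S : Finset (Fin n)) : Sym2 (Fin n) → ℝ :=
  Sym2.lift ⟨edgeProb p q S, fun i j => by simp only [edgeProb, and_comm]⟩

@[simp]
theorem edgeWeight_mk (i j : Fin n) : edgeWeight p q S s(i, j) = edgeProb p q S i j := rfl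

theorem edgeWeight_nonneg (hq : 0 ≤ q) (hqp : q ≤ p) (e : Sym2 (Fin n)) :
    0 ≤ edgeWeight p q S e := by
  induction e with
  | _ i j =>
    rw [edgeWeight_mk, edgeProb]
    split_ifs <;> linarith

theorem edgeWeight_le (hqp : q ≤ p) (e : Sym2 (Fin n)) : edgeWeight p q S e ≤ p := by
  induction e with
  | _ i j =>
    rw [edgeWeight_mk, edgeProb]
    split_ifs <;> linarith

open Classical in
/-- The edges of a graph on `Fin n`. -/
def edges (G : SimpleGraph (Fin n)) : Finset (Sym2 (Fin n)) :=
  (pairs Finset.univ).filter (fun e => e ∈ G.edgeSet)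

@[simp]
theorem mk_mem_edges {G : SimpleGraph (Fin n)} {i j : Fin n} : s(i, j) ∈ edges G ↔ G.Adj i j := by
  classical
  rw [edges, Finset.mem_filter, mk_mem_pairs, SimpleGraph.mem_edgeSet]
  exact ⟨fun h => h.2, fun h => ⟨⟨⟨Finset.mem_univ _, Finset.mem_univ _⟩, h.ne⟩, h⟩⟩

theorem edges_subset (G : SimpleGraph (Fin n)) : edges G ⊆ pairs Finset.univ := by
  classical
  exact Finset.filter_subset _ _

theorem edges_injective : Function.Injective (edges (n := n)) := by
  intro G H h
  ext i j
  rw [← mk_mem_edges, h, mk_mem_edges]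

open Classical in
theorem graphProb_eq_prod (H : SimpleGraph (Fin n)) :
    graphProb p q S H = (∏ e ∈ edges H, edgeWeight p q S e) *
      ∏ e ∈ pairs Finset.univ \ edges H, (1 - edgeWeight p q S e) := by
  have h1 : graphProb p q S H = ∏ e ∈ pairs (Finset.univ : Finset (Fin n)),
      if e ∈ edges H then edgeWeight p q S e else 1 - edgeWeight p q S e := by
    -- The sum formula over unordered pairs is read multiplicatively through `Additive ℝ`.
    have h2 : ∀ f : Sym2 (Fin n) → ℝ, ∏ e ∈ pairs (Finset.univ : Finset (Fin n)), f e =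
        ∏ e ∈ (Finset.univ : Finset (Fin n)).offDiag with e.1 < e.2, f s(e.1, e.2) := fun f =>
      Finset.sum_sym2_filter_not_isDiag (M := Additive ℝ) Finset.univ f
    rw [h2, graphProb]
    refine Finset.prod_congr ?_ fun e _ => ?_
    · ext e
      simp only [Finset.mem_filter, Finset.mem_univ, true_and, Finset.mem_offDiag]
      exact ⟨fun h => ⟨h.ne, h⟩, fun h => h.2⟩
    · simp only [mk_mem_edges, edgeWeight_mk]
  rw [h1, Finset.prod_ite]
  congr 1
  · rw [Finset.filter_mem_eq_inter,
      Finset.inter_eq_right.2 (edges_subset H)]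
  · rw [Finset.filter_notMem_eq_sdiff]

theorem sum_graphProb_mul [Fintype (SimpleGraph (Fin n))] (f : Finset (Sym2 (Fin n)) → ℝ) :
    ∑ H : SimpleGraph (Fin n), graphProb p q S H * f (edges H) =
      bernExp (edgeWeight p q S) (pairs Finset.univ) f := by
  rw [bernExp]
  refine Finset.sum_bij (fun H _ => edges H) ?_ ?_ ?_ ?_
  · exact fun H _ => Finset.mem_powerset.2 (edges_subset H)
  · exact fun H _ H' _ h => edges_injective h
  · intro E hE
    refine ⟨SimpleGraph.fromEdgeSet E, Finset.mem_univ _, ?_⟩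
    ext e
    induction e with
    | _ i j =>
      rw [mk_mem_edges, SimpleGraph.fromEdgeSet_adj, Finset.mem_coe, and_iff_left_iff_imp]
      exact fun h => (mk_mem_pairs.1 (Finset.mem_powerset.1 hE h)).2
  · exact fun H _ => by rw [graphProb_eq_prod]

theorem graphProb_nonneg (hq : 0 ≤ q) (hqp : q ≤ p) (hp : p ≤ 1) (H : SimpleGraph (Fin n)) :
    0 ≤ graphProb p q S H := by
  classical
  rw [graphProb_eq_prod]
  exact mul_nonneg (Finset.prod_nonneg fun e _ => edgeWeight_nonneg hq hqp e)
    (Finset.prod_nonneg fun e _ => sub_nonneg.2 ((edgeWeight_le hqp e).trans hp))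

theorem sum_graphProb [Fintype (SimpleGraph (Fin n))] :
    ∑ H : SimpleGraph (Fin n), graphProb p q S H = 1 := by
  classical
  have := sum_graphProb_mul (p := p) (q := q) (S := S) (fun _ => 1)
  simpa [bernExp_const] using this

end GraphLaw

/-! ### Message passing on a forest -/

section Messages

variable {n K N : ℕ} {p q : ℝ} {G : SimpleGraph (Fin n)}

open Classical in
/-- Along a tree step, a sum over edges to the next level is a sum over the next level. -/
theorem sum_edges_eq_sum_nextLevel {U A : Finset (Fin n)} (hT : IsTreeStep (edges G) U A)
    (f : Fin n → Fin n → ℝ) {par : Fin n → Fin n}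
    (hpar : ∀ l ∈ nextLevel (edges G) U A, par l ∈ A ∧ G.Adj (par l) l) :
    ∑ a ∈ A, ∑ l ∈ (U \ A).filter (fun l => G.Adj a l), f l a =
      ∑ l ∈ nextLevel (edges G) U A, f l (par l) := by
  have hnext : nextLevel (edges G) U A = (U \ A).filter (fun l => ∃ a ∈ A, G.Adj a l) := by
    ext l
    simp [mem_nextLevel]
  simp only [hnext, Finset.sum_filter] at hpar ⊢
  rw [Finset.sum_comm]
  refine Finset.sum_congr rfl fun l hl => ?_
  simp only [Finset.mem_filter, and_imp] at hpar
  split_ifs with h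
  · obtain ⟨h1, h2⟩ := hpar l hl h
    rw [Finset.sum_eq_single_of_mem (par l) h1, if_pos h2]
    intro b hb hne
    rw [if_neg]
    intro hbl
    exact hne (hT.2 l hl b hb _ h1 (by simpa using hbl) (by simpa using h2))
  · refine Finset.sum_eq_zero fun a ha => if_neg fun hal => h ⟨a, ha, hal⟩

-- On a forest the vertex excluded from a message's sum is the unique parent, so the message
-- collects exactly the children. The hypothesis that no unexplored vertex outside `A` is adjacent
-- to the explored region is the invariant of the induction. Exploration depth `r + 1` is needed for
-- messages of index `r`, since the first step already links `A` to its children.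
open Classical in
theorem sum_message_children (r : ℕ) : ∀ {U A : Finset (Fin n)}, A ⊆ U →
    (∀ l ∈ U \ A, ∀ b ∉ U, ¬ G.Adj l b) → IsTreeExploration N (edges G) (r + 1) U A →
    ∑ a ∈ A, ∑ l ∈ (U \ A).filter (fun l => G.Adj a l), message K p q G r l a =
      levelSum (centring n K p q) (√(scale n K q)) (edges G) r (U \ A)
        (nextLevel (edges G) U A) := by
  have hex : ∀ U A : Finset (Fin n), ∃ par : Fin n → Fin n,
      ∀ l ∈ nextLevel (edges G) U A, par l ∈ A ∧ G.Adj (par l) l := by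
    intro U A
    have : ∀ l, ∃ a, l ∈ nextLevel (edges G) U A → a ∈ A ∧ G.Adj a l := by
      intro l
      by_cases h : l ∈ nextLevel (edges G) U A
      · obtain ⟨a, ha, hal⟩ := (mem_nextLevel.1 h).2
        exact ⟨a, fun _ => ⟨ha, by simpa using hal⟩⟩
      · exact ⟨l, fun h' => absurd h' h⟩
    choose par hpar using this
    exact ⟨par, hpar⟩
  induction r with
  | zero =>
    intro U A hA hout hT
    obtain ⟨par, hpar⟩ := hex U A
    rw [sum_edges_eq_sum_nextLevel hT.2.1 _ hpar, levelSum]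
    simp [message]
  | succ r ih =>
    intro U A hA hout hT
    obtain ⟨par, hpar⟩ := hex U A
    obtain ⟨-, hstep, hnext⟩ := hT
    rw [sum_edges_eq_sum_nextLevel hstep _ hpar, levelSum, ← ih nextLevel_subset ?_ hnext]
    · simp only [message]
      rw [Finset.sum_add_distrib, Finset.sum_const, nsmul_eq_mul, mul_comm, ← Finset.mul_sum]
      congr 2
      refine Finset.sum_congr rfl fun l hl => Finset.sum_congr ?_ fun _ _ => rfl
      obtain ⟨hp1, hp2⟩ := hpar l hl
      have hlU := nextLevel_subset hl
      ext k
      simp only [Finset.mem_filter, Finset.mem_univ, true_and]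
      constructor
      -- A neighbour of `l` other than its parent is not in the explored region by the invariant,
      -- not in `A` by uniqueness of the parent, and not in the next level because the following
      -- tree step forbids edges there.
      · rintro ⟨hlk, hk⟩
        have hkU : k ∈ U := by
          by_contra hkU
          exact hout l hlU k hkU hlk
        have hkA : k ∉ A := fun hkA => hk (hstep.2 l hlU k hkA _ hp1
          (by simpa using hlk.symm) (by simpa using hp2))
        refine ⟨Finset.mem_sdiff.2 ⟨Finset.mem_sdiff.2 ⟨hkU, hkA⟩, fun hkn => ?_⟩, hlk⟩
        exact hnext.2.1.1 l hl k hkn (by simpa using hlk)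
      · rintro ⟨hk, hlk⟩
        refine ⟨hlk, ?_⟩
        rintro rfl
        exact (Finset.mem_sdiff.1 (Finset.mem_sdiff.1 hk).1).2 hp1
    · intro k hk b hb hkb
      obtain ⟨hk1, hk2⟩ := Finset.mem_sdiff.1 hk
      by_cases hbA : b ∈ A
      · exact hk2 (mem_nextLevel.2 ⟨hk1, b, hbA, by simpa using hkb.symm⟩)
      · exact hout k hk1 b (fun hbU => hb (Finset.mem_sdiff.2 ⟨hbU, hbA⟩)) hkb

open Classical in
/-- When the exploration from `u` meets a forest, the belief at `u` is the level sum. -/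
theorem beliefSucc_eq_levelSum (r : ℕ) (u : Fin n)
    (hT : IsTreeExploration N (edges G) (r + 1) Finset.univ {u}) :
    beliefSucc K p q G r u = levelSum (centring n K p q) (√(scale n K q)) (edges G) (r + 1)
      Finset.univ {u} := by
  have h := sum_message_children (K := K) (p := p) (q := q) r (Finset.subset_univ {u})
    (fun l _ b hb => absurd (Finset.mem_univ b) hb) hT
  rw [Finset.sum_singleton] at h
  rw [levelSum, ← h, beliefSucc, Finset.card_singleton, Nat.cast_one, mul_one]
  congr 3
  ext l
  simp only [Finset.mem_filter, Finset.mem_univ, true_and, Finset.mem_sdiff,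
    Finset.mem_singleton]
  exact ⟨fun h => ⟨h.ne', h⟩, fun h => h.2⟩

end Messages

/-! ### Exponential moments of the branching process -/

section MGFBound

theorem exp_sub_one_le {y : ℝ} (hy : |y| ≤ 1) : Real.exp y - 1 ≤ y + y ^ 2 := by
  have := (abs_le.1 (Real.abs_exp_sub_one_sub_id_le hy)).2
  linarith

/-- A recursion for means `a`, mean errors `e` and variance proxies `v` that controls the
exponential moments of the branching process. -/
theorem branchingMGF_le {V : Type*} [Fintype V] {w : Sym2 V → ℝ} {c : ℕ → ℝ} {R D : ℝ}
    (hw0 : ∀ e, 0 ≤ w e) (hw1 : ∀ e, w e ≤ 1) (hR : 1 ≤ R) (hD : ∀ i, ∑ l, w s(i, l) ≤ D)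
    {a : ℕ → V → ℝ} {e v : ℕ → ℝ} {T : ℕ}
    (ha0 : ∀ i, a 0 i = 1) (he0 : ∀ r, 0 ≤ e r) (hv0 : ∀ r, 0 ≤ v r)
    (hmean : ∀ r < T, ∀ i, |c r + (∑ l, w s(i, l) * a r l) / R - a (r + 1) i| + D * e r / R
      ≤ e (r + 1))
    (hvar : ∀ r < T, ∀ i, (∑ l, w s(i, l) * (v r + 3 * (a r l ^ 2 + e r ^ 2 + v r ^ 2 / R ^ 2)))
      / R ^ 2 ≤ v (r + 1))
    (hsmall : ∀ r < T, ∀ l, |a r l| / R + e r / R + v r / R ^ 2 ≤ 1) (r : ℕ) :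
    r ≤ T → ∀ (s : ℝ) (i : V), |s| ≤ 1 →
      branchingMGF w c R r s i ≤ Real.exp (s * a r i + |s| * e r + s ^ 2 * v r) := by
  have hR0 : 0 < R := by linarith
  induction r with
  | zero =>
    intro _ s i _
    rw [branchingMGF, Real.exp_le_exp, ha0]
    nlinarith [mul_nonneg (abs_nonneg s) (he0 0), mul_nonneg (sq_nonneg s) (hv0 0)]
  | succ r ih =>
    intro hr s i hs
    have hrT : r < T := hr
    have hs2 : s ^ 2 ≤ 1 := by rw [← sq_abs]; exact pow_le_one₀ (abs_nonneg s) hs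
    have hs2' : s ^ 2 ≤ |s| := by
      rw [← sq_abs, pow_two]
      exact mul_le_of_le_one_left (abs_nonneg s) hs
    have hsR : |s / R| ≤ 1 := by
      rw [abs_div, abs_of_pos hR0, div_le_one hR0]
      linarith
    -- The exponent supplied by the induction hypothesis at `s / R`; `hsmall` keeps it in [-1, 1],
    -- where exp y ≤ 1 + y + y² applies.
    set y : V → ℝ := fun l => s / R * a r l + |s / R| * e r + (s / R) ^ 2 * v r with hy
    have hyabs : ∀ l, |y l| ≤ 1 := by
      intro l
      have h1 : |y l| ≤ |s| * (|a r l| / R + e r / R + v r / R ^ 2) := by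
        have h2 : |y l| ≤ |s / R * a r l| + |s / R| * e r + (s / R) ^ 2 * v r := by
          refine (abs_add_le _ _).trans (add_le_add ((abs_add_le _ _).trans (add_le_add le_rfl ?_)) ?_)
          · rw [abs_of_nonneg (mul_nonneg (abs_nonneg _) (he0 r))]
          · rw [abs_of_nonneg (mul_nonneg (sq_nonneg _) (hv0 r))]
        have h3 : (s / R) ^ 2 * v r ≤ |s| * (v r / R ^ 2) := by
          rw [div_pow, div_mul_eq_mul_div, mul_div_assoc]
          exact mul_le_mul_of_nonneg_right hs2' (div_nonneg (hv0 r) (sq_nonneg _))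
        rw [abs_mul, abs_div, abs_of_pos hR0] at h2
        calc _ ≤ _ := h2
          _ ≤ |s| / R * |a r l| + |s| / R * e r + |s| * (v r / R ^ 2) := by linarith
          _ = _ := by ring
      calc _ ≤ _ := h1
        _ ≤ 1 * 1 := mul_le_mul hs (hsmall r hrT l) (by have := he0 r; have := hv0 r; positivity)
            zero_le_one
        _ = 1 := one_mul 1
    have hysq : ∀ l, y l + y l ^ 2 ≤ s * (a r l / R) + |s| * (e r / R) +
        s ^ 2 * ((v r + 3 * (a r l ^ 2 + e r ^ 2 + v r ^ 2 / R ^ 2)) / R ^ 2) := by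
      intro l
      have h4 : y l ^ 2 ≤ 3 * ((s / R * a r l) ^ 2 + (|s / R| * e r) ^ 2 +
          ((s / R) ^ 2 * v r) ^ 2) := by
        simp only [hy]
        nlinarith [sq_nonneg (s / R * a r l - |s / R| * e r),
          sq_nonneg (s / R * a r l - (s / R) ^ 2 * v r),
          sq_nonneg (|s / R| * e r - (s / R) ^ 2 * v r)]
      -- The term quartic in `s` is absorbed into the quadratic one using s² ≤ 1.
      have h5 : ((s / R) ^ 2 * v r) ^ 2 ≤ s ^ 2 * (v r ^ 2 / R ^ 2 / R ^ 2) := by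
        have : ((s / R) ^ 2 * v r) ^ 2 = s ^ 2 * (s ^ 2 * (v r ^ 2 / R ^ 2 / R ^ 2)) := by
          field_simp
        rw [this]
        refine mul_le_mul_of_nonneg_left ?_ (sq_nonneg s)
        exact mul_le_of_le_one_left (by positivity) hs2
      have h6 : (|s / R| * e r) ^ 2 = s ^ 2 * (e r ^ 2 / R ^ 2) := by
        rw [mul_pow, sq_abs]; field_simp
      have h7 : (s / R * a r l) ^ 2 = s ^ 2 * (a r l ^ 2 / R ^ 2) := by field_simp
      have h8 : y l = s * (a r l / R) + |s| * (e r / R) + s ^ 2 * (v r / R ^ 2) := by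
        simp only [hy]
        rw [abs_div, abs_of_pos hR0]
        ring
      rw [h6, h7] at h4
      calc y l + y l ^ 2 ≤ s * (a r l / R) + |s| * (e r / R) + s ^ 2 * (v r / R ^ 2) +
            3 * (s ^ 2 * (a r l ^ 2 / R ^ 2) + s ^ 2 * (e r ^ 2 / R ^ 2) +
              s ^ 2 * (v r ^ 2 / R ^ 2 / R ^ 2)) := by rw [← h8]; linarith
        _ = _ := by ring
    rw [branchingMGF]
    calc _ ≤ Real.exp (s * c r) * ∏ l, Real.exp (w s(i, l) * (s * (a r l / R) + |s| * (e r / R) +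
        s ^ 2 * ((v r + 3 * (a r l ^ 2 + e r ^ 2 + v r ^ 2 / R ^ 2)) / R ^ 2))) := by
          refine mul_le_mul_of_nonneg_left (Finset.prod_le_prod (fun l _ => ?_) fun l _ => ?_)
            (Real.exp_pos _).le
          · exact add_nonneg (sub_nonneg.2 (hw1 _))
              (mul_nonneg (hw0 _) (branchingMGF_nonneg hw0 hw1 _ _ _))
          · have h1 := ih (by omega) (s / R) l hsR
            have h2 := exp_sub_one_le (hyabs l)
            have h3 : branchingMGF w c R r (s / R) l - 1 ≤ s * (a r l / R) + |s| * (e r / R) +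
                s ^ 2 * ((v r + 3 * (a r l ^ 2 + e r ^ 2 + v r ^ 2 / R ^ 2)) / R ^ 2) :=
              (sub_le_sub_right h1 1).trans (h2.trans (hysq l))
            have h4 := mul_le_mul_of_nonneg_left h3 (hw0 s(i, l))
            -- The Bernoulli factor 1 + w(M - 1) is at most exp(w(M - 1)), which turns the product
            -- over labels into a sum of exponents.
            refine le_trans ?_ (Real.add_one_le_exp _)
            linarith
      _ = Real.exp (s * c r + (s * ((∑ l, w s(i, l) * a r l) / R) +
            |s| * ((∑ l, w s(i, l)) * e r / R) + s ^ 2 * ((∑ l, w s(i, l) * (v r + 3 * (a r l ^ 2 +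
              e r ^ 2 + v r ^ 2 / R ^ 2))) / R ^ 2))) := by
          rw [← Real.exp_sum, ← Real.exp_add]
          congr 2
          simp only [Finset.sum_mul, Finset.sum_div, Finset.mul_sum, ← Finset.sum_add_distrib]
          refine Finset.sum_congr rfl fun l _ => ?_
          ring
      _ ≤ _ := by
          rw [Real.exp_le_exp]
          have h1 := mul_le_mul_of_nonneg_left (hvar r hrT i) (sq_nonneg s)
          have h2 := mul_le_mul_of_nonneg_left (hmean r hrT i) (abs_nonneg s)
          have h3 : (∑ l, w s(i, l)) * e r / R ≤ D * e r / R :=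
            div_le_div_of_nonneg_right (mul_le_mul_of_nonneg_right (hD i) (he0 r)) hR0.le
          have h4 := mul_le_mul_of_nonneg_left h3 (abs_nonneg s)
          have h5 : s * (c r + (∑ l, w s(i, l) * a r l) / R - a (r + 1) i) ≤
              |s| * |c r + (∑ l, w s(i, l) * a r l) / R - a (r + 1) i| := by
            rw [← abs_mul]; exact le_abs_self _
          linarith

end MGFBound

/-! ### Means and variance proxies for the planted model -/

section Moments

variable {n K : ℕ} {p q : ℝ} {S : Finset (Fin n)}

/-- The mean of the belief of depth `r` at a vertex, for a community of size exactly `K`. -/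
def beliefMean (K : ℕ) (p q : ℝ) (S : Finset (Fin n)) (r : ℕ) (i : Fin n) : ℝ :=
  if i ∈ S then meanInside n K p q r else meanOutside r

theorem sum_edgeWeight_mul (i : Fin n) (f : Fin n → ℝ) {x y : ℝ} (hx : ∀ l ∈ S, f l = x)
    (hy : ∀ l ∉ S, f l = y) : ∑ l, edgeWeight p q S s(i, l) * f l =
      (if i ∈ S then p else q) * S.card * x + q * (n - S.card) * y := by
  rw [← Finset.sum_add_sum_compl S]
  congr 1
  · rw [Finset.sum_congr rfl (g := fun _ => (if i ∈ S then p else q) * x), Finset.sum_const,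
      nsmul_eq_mul]
    · ring
    · intro l hl
      rw [hx l hl, edgeWeight_mk, edgeProb]
      simp [hl]
  · rw [Finset.sum_congr rfl (g := fun _ => q * y), Finset.sum_const, nsmul_eq_mul,
      Finset.card_compl, Fintype.card_fin, Nat.cast_sub (by simpa using Finset.card_le_univ S)]
    · ring
    · intro l hl
      have hl := Finset.mem_compl.1 hl
      rw [hy l hl, edgeWeight_mk, edgeProb]
      simp [hl]

theorem sum_edgeWeight_le (hq : 0 ≤ q) (hqp : q ≤ p) (i : Fin n) :
    ∑ l, edgeWeight p q S s(i, l) ≤ q * n + p * S.card := by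
  have := sum_edgeWeight_mul (p := p) (q := q) (S := S) i (fun _ => 1) (x := 1) (y := 1)
    (fun _ _ => rfl) (fun _ _ => rfl)
  simp only [mul_one] at this
  rw [this]
  have h1 : (if i ∈ S then p else q) * (S.card : ℝ) ≤ p * S.card :=
    mul_le_mul_of_nonneg_right (by split_ifs <;> linarith) (Nat.cast_nonneg _)
  nlinarith [mul_nonneg hq (Nat.cast_nonneg (α := ℝ) S.card)]

theorem meanInside_zero : meanInside n K p q 0 = 1 := by simp [meanInside]

theorem meanInside_succ (hlam : 0 < snr n K p q) (r : ℕ) :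
    meanInside n K p q (r + 1) = √(snr n K p q) * meanInside n K p q r := by
  rw [meanInside, meanInside, Real.sqrt_eq_rpow, ← Real.rpow_add hlam]
  congr 1
  push_cast
  ring

theorem meanInside_pos (hlam : 0 < snr n K p q) (r : ℕ) : 0 < meanInside n K p q r :=
  Real.rpow_pos_of_pos hlam _

theorem meanInside_mono (hlam : 1 ≤ snr n K p q) {r t : ℕ} (h : r ≤ t) :
    meanInside n K p q r ≤ meanInside n K p q t :=
  Real.rpow_le_rpow_of_exponent_le hlam (by gcongr)

theorem sqrt_snr (hqp : q ≤ p) : √(snr n K p q) = K * (p - q) / √(scale n K q) := by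
  rw [snr, ← mul_pow, Real.sqrt_div (sq_nonneg _),
    Real.sqrt_sq (mul_nonneg (Nat.cast_nonneg _) (sub_nonneg.2 hqp)), scale]

/-- The centring cancels the mean exactly when |S| = K, because √λ = K(p - q)/√m. What remains is
linear in |S| - K. -/
theorem abs_mean_error_le (hq : 0 ≤ q) (hqp : q ≤ p) (hlam : 0 < snr n K p q) (r : ℕ)
    (i : Fin n) :
    |centring n K p q r + (∑ l, edgeWeight p q S s(i, l) * beliefMean K p q S r l) /
        √(scale n K q) - beliefMean K p q S (r + 1) i| ≤
      p * |(S.card : ℝ) - K| * meanInside n K p q r / √(scale n K q) := by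
  have hB := meanInside_pos hlam r
  have hkey : ∀ x : ℝ, 0 ≤ x → x ≤ p →
      |x * ((S.card : ℝ) - K) * meanInside n K p q r / √(scale n K q)| ≤
      p * |(S.card : ℝ) - K| * meanInside n K p q r / √(scale n K q) := by
    intro x hx hxp
    rw [abs_div, abs_mul, abs_mul, abs_of_nonneg hx, abs_of_pos hB,
      abs_of_nonneg (Real.sqrt_nonneg _)]
    gcongr
  have hsucc : meanInside n K p q (r + 1) =
      K * (p - q) / √(scale n K q) * meanInside n K p q r := by
    rw [meanInside_succ hlam, sqrt_snr hqp]
  rw [sum_edgeWeight_mul i _ (x := meanInside n K p q r) (y := meanOutside r)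
    (fun l hl => by simp [beliefMean, hl]) (fun l hl => by simp [beliefMean, hl])]
  have hout : meanOutside (r + 1) = 0 := by simp [meanOutside]
  -- A_r B_r = A_r, because B_0 = 1 and A_r = 0 afterwards. Hence both errors have the form y(|S| -
  -- K)B_r/√m with 0 ≤ y ≤ p.
  have h00 : (meanOutside r) = meanOutside r * meanInside n K p q r := by
    rcases Nat.eq_zero_or_pos r with rfl | hr
    · rw [meanInside_zero, mul_one]
    · simp [meanOutside, hr.ne']
  have h01 : 0 ≤ meanOutside r ∧ meanOutside r ≤ 1 := by
    rw [meanOutside]; split_ifs <;> norm_num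
  by_cases hi : i ∈ S
  · refine le_trans (le_of_eq ?_) (hkey (p - q * meanOutside r) ?_ ?_)
    · congr 1
      rw [beliefMean, if_pos hi, if_pos hi, hsucc, centring]
      rw [show (p - q * meanOutside r) * ((S.card : ℝ) - K) * meanInside n K p q r =
        p * ((S.card : ℝ) - K) * meanInside n K p q r - q * ((S.card : ℝ) - K) * (meanOutside r *
        meanInside n K p q r) by ring, ← h00]
      ring
    · nlinarith
    · nlinarith
  · refine le_trans (le_of_eq ?_) (hkey (q - q * meanOutside r) ?_ ?_)
    · congr 1
      rw [beliefMean, if_neg hi, if_neg hi, hout, centring]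
      rw [show (q - q * meanOutside r) * ((S.card : ℝ) - K) * meanInside n K p q r =
        q * ((S.card : ℝ) - K) * meanInside n K p q r - q * ((S.card : ℝ) - K) * (meanOutside r *
        meanInside n K p q r) by ring, ← h00]
      ring
    · nlinarith
    · nlinarith

/-- As v ≤ 8, the factor 1 + ρ inflates v by at most 8ρ; the quadratic corrections 3(ε² + 64/m) are
at most doubled, whence 6ε² and 384/m. -/
theorem variance_step_le {m ρ e ε v D : ℝ} (hm : 0 < m) (hρ0 : 0 ≤ ρ) (hρ1 : ρ ≤ 1)
    (he0 : 0 ≤ e) (he : e ≤ ε) (hv0 : 0 ≤ v) (hv : v ≤ 8) (hD0 : 0 ≤ D) (hD : D ≤ (1 + ρ) * m) :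
    (v + 3 * (e ^ 2 + v ^ 2 / m)) * D ≤ (v + (8 * ρ + 6 * ε ^ 2 + 384 / m)) * m := by
  have heε : e ^ 2 ≤ ε ^ 2 := pow_le_pow_left₀ he0 he 2
  have hv2 : v ^ 2 / m ≤ 64 / m := div_le_div_of_nonneg_right (by nlinarith) hm.le
  have h64 : 0 ≤ 64 / m := by positivity
  have hε2 : 0 ≤ ε ^ 2 := sq_nonneg ε
  have h3 : (v + 3 * (e ^ 2 + v ^ 2 / m)) * D ≤ (v + 3 * (ε ^ 2 + 64 / m)) * ((1 + ρ) * m) :=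
    mul_le_mul (by linarith) hD hD0 (by linarith)
  have h5 : v * ρ ≤ 8 * ρ := mul_le_mul_of_nonneg_right hv hρ0
  have h6 : 3 * (ε ^ 2 + 64 / m) * (1 + ρ) ≤ 3 * (ε ^ 2 + 64 / m) * 2 :=
    mul_le_mul_of_nonneg_left (by linarith) (by linarith)
  have h7 : 384 / m = 6 * (64 / m) := by ring
  have h4 : (v + 3 * (ε ^ 2 + 64 / m)) * (1 + ρ) ≤ v + (8 * ρ + 6 * ε ^ 2 + 384 / m) := by
    rw [h7]
    linarith
  have h8 := mul_le_mul_of_nonneg_right h4 hm.le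
  linarith

theorem branchingMGF_beliefMean_le (hq : 0 ≤ q) (hqp : q ≤ p) (hp : p ≤ 1)
    (hm : 1 ≤ scale n K q) (hlam : 1 ≤ snr n K p q) {T : ℕ} {ρ β J ε : ℝ} (hρ1 : ρ ≤ 1)
    (hD : q * n + p * S.card ≤ (1 + ρ) * scale n K q)
    (hJ : p * |(S.card : ℝ) - K| * meanInside n K p q T / √(scale n K q) ≤ J)
    (hε : T * (2 * √(scale n K q)) ^ T * J ≤ ε) (hε1 : ε ≤ 1)
    (hsmall : meanInside n K p q T + 9 ≤ √(scale n K q))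
    (hβ : 8 * ρ + 6 * ε ^ 2 + 384 / scale n K q +
      3 * (p * S.card * meanInside n K p q T ^ 2 / scale n K q) ≤ β) (hTβ : T * β ≤ 2)
    (s : ℝ) (i : Fin n) (hs : |s| ≤ 1) :
    branchingMGF (edgeWeight p q S) (centring n K p q) √(scale n K q) T s i ≤
      Real.exp (s * beliefMean K p q S T i + 9) := by
  have hp0 : 0 ≤ p := hq.trans hqp
  have hlam0 : 0 < snr n K p q := by linarith
  set m := scale n K q with hmdef
  set R := √m with hRdef
  have hm0 : 0 < m := by linarith
  have hR : 1 ≤ R := Real.one_le_sqrt.2 hm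
  have hR0 : 0 < R := by linarith
  have hR2 : R ^ 2 = m := Real.sq_sqrt hm0.le
  have hBT : 1 ≤ meanInside n K p q T := by
    rw [← meanInside_zero (n := n) (K := K) (p := p) (q := q)]
    exact meanInside_mono hlam (Nat.zero_le T)
  have hρ0 : 0 ≤ ρ := by
    have h1 : m ≤ q * n + p * S.card := by
      have h2 : m = q * n - q * K := by rw [hmdef, scale]; ring
      have h3 : 0 ≤ q * K := by positivity
      have h4 : 0 ≤ p * S.card := by positivity
      linarith
    have h2 : 0 ≤ ρ * m := by linarith
    exact nonneg_of_mul_nonneg_left h2 hm0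
  have hJ0 : 0 ≤ J := le_trans (by positivity) hJ
  have hε0 : 0 ≤ ε := le_trans (by positivity) hε
  have hβ0 : 0 ≤ β := le_trans (by positivity) hβ
  have hw0 : ∀ e, 0 ≤ edgeWeight p q S e := edgeWeight_nonneg hq hqp
  have hw1 : ∀ e, edgeWeight p q S e ≤ 1 := fun e => (edgeWeight_le hqp e).trans hp
  have hDi : ∀ i, ∑ l, edgeWeight p q S s(i, l) ≤ (1 + ρ) * m := fun i =>
    (sum_edgeWeight_le hq hqp i).trans hD
  have he : ∀ r ≤ T, (r : ℝ) * (2 * R) ^ r * J ≤ ε := by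
    intro r hr
    refine le_trans ?_ hε
    refine mul_le_mul_of_nonneg_right (mul_le_mul (by exact_mod_cast hr)
      (pow_le_pow_right₀ (by linarith) hr) (by positivity) (by positivity)) hJ0
  -- The initial value is deterministic, so its proxy is 0. The first step costs at most 3(1 + ρ) ≤
  -- 6, all vertices having mean 1; each later step costs at most β. With Tβ ≤ 2 the proxy never
  -- exceeds 8.
  set v : ℕ → ℝ := fun r => if r = 0 then 0 else 6 + r * β with hv
  have hv0 : ∀ r, 0 ≤ v r := by
    intro r
    simp only [hv]
    split_ifs
    · exact le_rfl
    · positivity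
  have hv8 : ∀ r ≤ T, v r ≤ 8 := by
    intro r hr
    have : (r : ℝ) * β ≤ T * β := mul_le_mul_of_nonneg_right (by exact_mod_cast hr) hβ0
    simp only [hv]
    split_ifs <;> linarith
  -- The mean error r(2R)^r J solves e ↦ J + De/R with room to spare, since D/R = (1 + ρ)R ≤ 2R. Its
  -- final value is at most 1, and 9 is this 1 plus the 8 of the variance proxy.
  have hmain := branchingMGF_le (w := edgeWeight p q S) (c := centring n K p q) (R := R)
    (D := (1 + ρ) * m) hw0 hw1 hR hDi (a := beliefMean K p q S) (T := T)
    (e := fun r => r * (2 * R) ^ r * J) (v := v) ?_ ?_ hv0 ?_ ?_ ?_ T le_rfl s i hs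
  · refine hmain.trans (Real.exp_le_exp.2 ?_)
    have h1 : |s| * (T * (2 * R) ^ T * J) ≤ 1 * 1 :=
      mul_le_mul hs (hε.trans hε1) (by positivity) zero_le_one
    have h2 : s ^ 2 * v T ≤ 1 * 8 := by
      refine mul_le_mul ?_ (hv8 T le_rfl) (hv0 T) zero_le_one
      rw [← sq_abs]
      exact pow_le_one₀ (abs_nonneg s) hs
    linarith
  · intro i
    simp [beliefMean, meanInside_zero, meanOutside]
  · intro r
    positivity
  · intro r hr i
    have h1 := abs_mean_error_le (S := S) hq hqp hlam0 r i
    have h2 : p * |(S.card : ℝ) - K| * meanInside n K p q r / R ≤ J := by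
      refine le_trans ?_ hJ
      have := meanInside_mono hlam hr.le
      gcongr
    have h3 : (1 + ρ) * m * (r * (2 * R) ^ r * J) / R ≤ r * (2 * R) ^ (r + 1) * J := by
      rw [← hR2, div_le_iff₀ hR0]
      have : 0 ≤ (r : ℝ) * (2 * R) ^ r * J * R ^ 2 * (1 - ρ) := by
        have : 0 ≤ 1 - ρ := by linarith
        positivity
      have h4 : (r : ℝ) * (2 * R) ^ (r + 1) * J * R = 2 * (r * (2 * R) ^ r * J * R ^ 2) := by ring
      rw [h4]
      linarith
    have h5 : J ≤ (2 * R) ^ (r + 1) * J :=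
      le_mul_of_one_le_left hJ0 (one_le_pow₀ (by linarith))
    calc _ ≤ J + r * (2 * R) ^ (r + 1) * J := add_le_add (h1.trans h2) h3
      _ ≤ (2 * R) ^ (r + 1) * J + r * (2 * R) ^ (r + 1) * J := by linarith
      _ = _ := by push_cast; ring
  · intro r hr i
    rw [hR2, div_le_iff₀ hm0]
    set e : ℝ := r * (2 * R) ^ r * J with hedef
    have he0 : 0 ≤ e := by positivity
    have hsplit : ∑ l, edgeWeight p q S s(i, l) * (v r + 3 * (beliefMean K p q S r l ^ 2 + e ^ 2 +
        v r ^ 2 / m)) = (v r + 3 * (e ^ 2 + v r ^ 2 / m)) * ∑ l, edgeWeight p q S s(i, l) +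
        3 * ∑ l, edgeWeight p q S s(i, l) * beliefMean K p q S r l ^ 2 := by
      simp only [Finset.mul_sum, ← Finset.sum_add_distrib]
      exact Finset.sum_congr rfl fun l _ => by ring
    rw [hsplit]
    have hvs : v (r + 1) = 6 + (r + 1) * β := by simp [hv]
    rw [hvs]
    rcases Nat.eq_zero_or_pos r with rfl | hr0
    · have : ∑ l, edgeWeight p q S s(i, l) * beliefMean K p q S 0 l ^ 2 =
          ∑ l, edgeWeight p q S s(i, l) :=
        Finset.sum_congr rfl fun l _ => by simp [beliefMean, meanInside_zero, meanOutside]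
      rw [this]
      have hv00 : v 0 = 0 := by simp [hv]
      have he00 : e = 0 := by simp [hedef]
      rw [hv00, he00]
      have h1 := hDi i
      have h2 : 0 ≤ (1 - ρ) * m := mul_nonneg (by linarith) hm0.le
      have h3 : 0 ≤ β * m := mul_nonneg hβ0 hm0.le
      have h4 : 3 * (0 ^ 2 + 0 ^ 2 / m) = 0 := by norm_num
      rw [Nat.cast_zero, zero_add (3 * (0 ^ 2 + 0 ^ 2 / m) : ℝ), h4, zero_mul, zero_add]
      linarith
    · have hmo : meanOutside r = 0 := by simp [meanOutside, hr0.ne']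
      have h1 : ∑ l, edgeWeight p q S s(i, l) * beliefMean K p q S r l ^ 2 ≤
          p * S.card * meanInside n K p q T ^ 2 := by
        rw [sum_edgeWeight_mul i _ (x := meanInside n K p q r ^ 2) (y := 0)
          (fun l hl => by simp [beliefMean, hl]) (fun l hl => by simp [beliefMean, hl, hmo]),
          mul_zero, add_zero]
        have := meanInside_mono hlam hr.le
        have := (meanInside_pos hlam0 r).le
        have hif : (if i ∈ S then p else q) ≤ p := by split_ifs <;> linarith
        gcongr
      have h2 : p * S.card * meanInside n K p q T ^ 2 =
          p * S.card * meanInside n K p q T ^ 2 / m * m := (div_mul_cancel₀ _ hm0.ne').symm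
      have hvr : v r = 6 + r * β := by simp [hv, hr0.ne']
      have h3 := variance_step_le hm0 hρ0 hρ1 he0 (he r hr.le) (hv0 r) (hv8 r hr.le)
        (Finset.sum_nonneg fun _ _ => hw0 _) (hDi i)
      have h9 := mul_le_mul_of_nonneg_right hβ hm0.le
      have h10 : (6 + (r + 1) * β) * m = (v r + β) * m := by rw [hvr]; ring
      rw [h10]
      linarith
  · intro r hr l
    have h1 : |beliefMean K p q S r l| ≤ meanInside n K p q T := by
      rw [beliefMean]
      split_ifs
      · rw [abs_of_pos (meanInside_pos hlam0 r)]
        exact meanInside_mono hlam hr.le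
      · rw [meanOutside]
        split_ifs
        · simpa using hBT
        · simpa using zero_le_one.trans hBT
    have h2 : v r / R ^ 2 ≤ 8 / R := by
      refine div_le_div₀ (by norm_num) (hv8 r hr.le) hR0 ?_
      nlinarith
    have h3 : |beliefMean K p q S r l| / R + r * (2 * R) ^ r * J / R + 8 / R ≤ 1 := by
      rw [← add_div, ← add_div, div_le_one hR0]
      have := (he r hr.le).trans hε1
      linarith
    linarith

end Moments

/-! ### Chernoff bound for one vertex, and selection of the top K -/

section Classification

variable {n K N : ℕ} {p q : ℝ} {S : Finset (Fin n)}

open Classical in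
/-- The vertices whose belief exceeds half of its mean inside the community. -/
def aboveThreshold (K : ℕ) (p q : ℝ) (r : ℕ) (H : SimpleGraph (Fin n)) : Finset (Fin n) :=
  Finset.univ.filter (fun i => meanInside n K p q (r + 1) / 2 < beliefSucc K p q H r i)

/-- The probability that a vertex is misclassified by thresholding its belief. -/
theorem misclassification_le (hq : 0 ≤ q) (hqp : q ≤ p) (hp : p < 1) (hN0 : 0 < N) (r : ℕ)
    (i : Fin n) (hM : ∀ s : ℝ, |s| ≤ 1 →
      branchingMGF (edgeWeight p q S) (centring n K p q) √(scale n K q) (r + 1) s i ≤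
        Real.exp (s * beliefMean K p q S (r + 1) i + 9)) :
    ∑ H : SimpleGraph (Fin n), graphProb p q S H *
        (if i ∈ symmDiff S (aboveThreshold K p q r H) then 1 else 0) ≤
      ((1 - p) ^ (N ^ 2))⁻¹ ^ (r + 1) * Real.exp (9 - meanInside n K p q (r + 1) / 2) +
      (((r + 1 : ℕ) : ℝ) * (N ^ 2 * p + n * N ^ 2 * p ^ 2) +
        (∑ t ∈ Finset.range (r + 2), (n * p) ^ t) / N) := by
  classical
  have hp0 : 0 ≤ p := hq.trans hqp
  set B := meanInside n K p q (r + 1) with hB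
  have hw0 : ∀ e, 0 ≤ edgeWeight p q S e := edgeWeight_nonneg hq hqp
  have hwp : ∀ e, edgeWeight p q S e ≤ p := edgeWeight_le hqp
  -- The Chernoff parameter: the lower tail is needed inside the community and the upper tail
  -- outside. Both means lie at distance B/2 from the threshold.
  set σ : ℝ := if i ∈ S then -1 else 1 with hσ
  have hσ1 : |σ| ≤ 1 := by rw [hσ]; split_ifs <;> simp
  have hσa : σ * beliefMean K p q S (r + 1) i + -(σ * (B / 2)) = -(B / 2) := by
    rw [hσ, beliefMean, meanOutside]
    split_ifs
    · ring
    · exact absurd ‹False› id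
    · ring
  set W : Finset (Sym2 (Fin n)) → ℝ := fun E => levelSum (centring n K p q) √(scale n K q) E
    (r + 1) Finset.univ {i} with hW
  -- `F` dominates the misclassification indicator: on the forest event it is exp(σ(belief - B/2)),
  -- which is at least one at an error, and off that event it is one.
  obtain ⟨F, hF⟩ : ∃ F : Finset (Sym2 (Fin n)) → ℝ, F = fun E =>
      Real.exp (-(σ * (B / 2))) * (if IsTreeExploration N E (r + 1) Finset.univ {i} then
        Real.exp (σ * W E) else 0) +
      (if IsTreeExploration N E (r + 1) Finset.univ {i} then 0 else 1) := ⟨_, rfl⟩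
  calc _ ≤ ∑ H : SimpleGraph (Fin n), graphProb p q S H * F (edges H) := by
        refine Finset.sum_le_sum fun H _ => mul_le_mul_of_nonneg_left ?_
          (graphProb_nonneg hq hqp hp.le H)
        rw [hF]
        by_cases hT : IsTreeExploration N (edges H) (r + 1) Finset.univ {i}
        · simp only [if_pos hT, add_zero]
          rw [← Real.exp_add]
          split_ifs with hmis
          · refine Real.one_le_exp ?_
            have hb := beliefSucc_eq_levelSum (K := K) (p := p) (q := q) r i hT
            simp only [aboveThreshold, Finset.mem_symmDiff, Finset.mem_filter, Finset.mem_univ,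
              true_and, hb] at hmis
            simp only [hW, hσ]
            rcases hmis with ⟨hi, h⟩ | ⟨h, hi⟩
            · rw [if_pos hi]
              push Not at h
              linarith
            · rw [if_neg hi]
              linarith
          · exact (Real.exp_pos _).le
        · simp only [if_neg hT, mul_zero, zero_add]
          split_ifs <;> norm_num
    _ = Real.exp (-(σ * (B / 2))) * bernExp (edgeWeight p q S) (pairs Finset.univ) (fun E =>
          if IsTreeExploration N E (r + 1) Finset.univ {i} then Real.exp (σ * W E) else 0) +
        bernExp (edgeWeight p q S) (pairs Finset.univ) (fun E =>
          if IsTreeExploration N E (r + 1) Finset.univ {i} then 0 else 1) := by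
        rw [sum_graphProb_mul, hF, bernExp_add, bernExp_const_mul]
    _ ≤ Real.exp (-(σ * (B / 2))) * (((1 - p) ^ (N ^ 2))⁻¹ ^ (r + 1) *
          Real.exp (σ * beliefMean K p q S (r + 1) i + 9)) + _ := by
        refine add_le_add (mul_le_mul_of_nonneg_left ?_ (Real.exp_pos _).le)
          (bernExp_not_isTreeExploration_le hw0 hwp hp0 hp.le hN0 (r + 1) _ _
            (Finset.subset_univ _))
        refine (bernExp_exp_levelSum_le hw0 hwp hp0 hp (r + 1) σ _ _
          (Finset.subset_univ _)).trans ?_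
        rw [Finset.prod_singleton]
        exact mul_le_mul_of_nonneg_left (hM σ hσ1)
          (pow_nonneg (inv_nonneg.2 (pow_nonneg (by linarith) _)) _)
    _ = _ := by
        congr 1
        · rw [mul_left_comm, ← Real.exp_add]
          congr 2
          linarith
        · simp

theorem card_symmDiff_triangle {α : Type*} [DecidableEq α] (A B C : Finset α) :
    (symmDiff A C).card ≤ (symmDiff A B).card + (symmDiff B C).card :=
  (Finset.card_le_card (symmDiff_triangle A B C)).trans (Finset.card_union_le _ _)

theorem abs_card_sub_card_le {α : Type*} [DecidableEq α] (A B : Finset α) :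
    |(A.card : ℝ) - B.card| ≤ (symmDiff A B).card := by
  have h1 := Finset.card_sdiff_add_card_inter A B
  have h2 := Finset.card_sdiff_add_card_inter B A
  rw [Finset.inter_comm] at h2
  have h3 : (symmDiff A B).card = (A \ B).card + (B \ A).card :=
    Finset.card_union_of_disjoint disjoint_sdiff_sdiff
  rw [abs_le, h3, ← h1, ← h2]
  push_cast
  constructor <;> linarith [Nat.cast_nonneg (α := ℝ) (A \ B).card,
    Nat.cast_nonneg (α := ℝ) (B \ A).card]

theorem card_symmDiff_of_subset {α : Type*} [DecidableEq α] {A B : Finset α} (h : A ⊆ B) :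
    ((symmDiff A B).card : ℝ) = |(A.card : ℝ) - B.card| := by
  have h3 : symmDiff A B = B \ A := by
    rw [symmDiff, Finset.sup_eq_union, Finset.sdiff_eq_empty_iff_subset.2 h, Finset.empty_union]
  rw [h3, Finset.cast_card_sdiff h, abs_sub_comm, abs_of_nonneg]
  rw [sub_nonneg, Nat.cast_le]
  exact Finset.card_le_card h

open Classical in
/-- The top set of `f` is close to `S` whenever a superlevel set of `f` is. -/
theorem IsTopSet.card_symmDiff_le {f : Fin n → ℝ} {Shat : Finset (Fin n)}
    (h : IsTopSet K f Shat) (S : Finset (Fin n)) (τ : ℝ) :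
    ((symmDiff S Shat).card : ℝ) ≤
      2 * (symmDiff S (Finset.univ.filter (fun i => τ < f i))).card + |(S.card : ℝ) - K| := by
  set Θ := Finset.univ.filter (fun i => τ < f i) with hΘ
  -- A top set and a strict superlevel set of the same function are nested, so their symmetric
  -- difference is determined by their sizes.
  have hnest : Shat ⊆ Θ ∨ Θ ⊆ Shat := by
    by_contra! hc
    obtain ⟨h1, h2⟩ := hc
    obtain ⟨i, hi, hiΘ⟩ := Finset.not_subset.1 h1
    obtain ⟨j, hj, hjS⟩ := Finset.not_subset.1 h2
    have := h.2 i hi j hjS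
    simp only [hΘ, Finset.mem_filter, Finset.mem_univ, true_and, not_lt] at hiΘ hj
    linarith
  have h1 : ((symmDiff Θ Shat).card : ℝ) = |(Θ.card : ℝ) - K| := by
    rw [← h.1]
    rcases hnest with hs | hs
    · rw [symmDiff_comm, card_symmDiff_of_subset hs, abs_sub_comm]
    · exact card_symmDiff_of_subset hs
  have h2 : ((symmDiff S Shat).card : ℝ) ≤ (symmDiff S Θ).card + (symmDiff Θ Shat).card := by
    exact_mod_cast card_symmDiff_triangle S Θ Shat
  have h3 := abs_card_sub_card_le S Θ
  have h4 : |(Θ.card : ℝ) - K| ≤ |(S.card : ℝ) - Θ.card| + |(S.card : ℝ) - K| := by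
    rw [abs_sub_comm (S.card : ℝ) Θ.card]
    exact abs_sub_le _ _ _
  linarith

end Classification

/-! ### From conditional probabilities to the expected error -/

section Expectation

variable {n : ℕ} {p q : ℝ} {Ω : Type*} [MeasurableSpace Ω] {μ : Measure Ω}
  {C : Ω → Finset (Fin n)} {G : Ω → SimpleGraph (Fin n)}

theorem IsPlantedDenseSubgraph.integral_eq [IsProbabilityMeasure μ]
    (h : IsPlantedDenseSubgraph μ p q C G) (f : Finset (Fin n) → SimpleGraph (Fin n) → ℝ) :
    Integrable (fun ω => f (C ω) (G ω)) μ ∧ ∫ ω, f (C ω) (G ω) ∂μ =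
      ∑ S, μ.real {ω | C ω = S} * ∑ H, graphProb p q S H * f S H := by
  classical
  have hmeas : ∀ S H, MeasurableSet {ω | C ω = S ∧ G ω = H} := fun S H =>
    (h.measurable_community S).inter (h.measurable_graph H)
  have hf : (fun ω => f (C ω) (G ω)) = fun ω => ∑ S, ∑ H,
      ({ω | C ω = S ∧ G ω = H}).indicator (fun _ => f S H) ω := by
    ext ω
    rw [Finset.sum_eq_single (C ω), Finset.sum_eq_single (G ω)]
    · simp
    · intro H _ hH
      simp [hH.symm]
    · simp
    · intro S _ hS
      simp [hS.symm]
    · simp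
  have hint : ∀ S H, Integrable
      (({ω | C ω = S ∧ G ω = H}).indicator (fun _ => f S H)) μ := fun S H =>
    (integrable_const _).indicator (hmeas S H)
  rw [hf]
  refine ⟨integrable_finsetSum _ fun S _ => integrable_finsetSum _ fun H _ => hint S H, ?_⟩
  rw [integral_finsetSum _ fun S _ => integrable_finsetSum _ fun H _ => hint S H]
  refine Finset.sum_congr rfl fun S _ => ?_
  rw [integral_finsetSum _ fun H _ => hint S H, Finset.mul_sum]
  refine Finset.sum_congr rfl fun H _ => ?_
  rw [integral_indicator_const _ (hmeas S H), h.law, smul_eq_mul, mul_assoc]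

theorem IsPlantedDenseSubgraph.sum_real_community [IsProbabilityMeasure μ]
    (h : IsPlantedDenseSubgraph μ p q C G) : ∑ S, μ.real {ω | C ω = S} = 1 := by
  have := (h.integral_eq (fun _ _ => 1)).2
  simpa [sum_graphProb] using this.symm

open Classical in
theorem IsPlantedDenseSubgraph.real_community [IsProbabilityMeasure μ]
    (h : IsPlantedDenseSubgraph μ p q C G) (P : Finset (Fin n) → Prop) :
    μ.real {ω | P (C ω)} = ∑ S, μ.real {ω | C ω = S} * if P S then 1 else 0 := by
  have h1 := (h.integral_eq (fun S _ => if P S then 1 else 0)).2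
  have h2 : MeasurableSet {ω | P (C ω)} := by
    have : {ω | P (C ω)} = ⋃ S ∈ (Finset.univ.filter P : Finset (Finset (Fin n))),
        {ω | C ω = S} := by
      ext ω
      simp
    rw [this]
    exact Finset.measurableSet_biUnion _ fun S _ => h.measurable_community S
  have h3 : (fun ω => if P (C ω) then (1 : ℝ) else 0) = ({ω | P (C ω)}).indicator 1 := by
    ext ω
    simp [Set.indicator_apply]
  rw [h3, integral_indicator_one h2] at h1
  rw [h1]
  refine Finset.sum_congr rfl fun S _ => ?_
  rw [← Finset.sum_mul, sum_graphProb, one_mul]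

/-- The expected error, when every vertex is misclassified with probability at most `δ` given
any community of typical size. -/
theorem integral_card_symmDiff_le [IsProbabilityMeasure μ] {K r : ℕ} {δ x : ℝ} (hδ : 0 ≤ δ) (hx : 0 ≤ x)
    (h : IsPlantedDenseSubgraph μ p q C G) {Chat : Ω → Finset (Fin n)}
    (hChat : ∀ᵐ ω ∂μ, IsTopSet K (beliefSucc K p q (G ω) r) (Chat ω))
    (hmis : ∀ S : Finset (Fin n), |(S.card : ℝ) - K| < x → ∀ i,
      ∑ H : SimpleGraph (Fin n), graphProb p q S H *
        (if i ∈ symmDiff S (aboveThreshold K p q r H) then 1 else 0) ≤ δ) :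
    ∫ ω, ((symmDiff (C ω) (Chat ω)).card : ℝ) ∂μ ≤
      2 * (n * δ) + x + n * μ.real {ω | x ≤ |((C ω).card : ℝ) - K|} := by
  classical
  -- The estimator may break ties by extra randomness, so its error is dominated by a function of
  -- the community and the graph alone, to which the model's joint law applies.
  set f : Finset (Fin n) → SimpleGraph (Fin n) → ℝ := fun S H =>
    if x ≤ |(S.card : ℝ) - K| then n else
      2 * (symmDiff S (aboveThreshold K p q r H)).card + |(S.card : ℝ) - K| with hf
  obtain ⟨hint, heq⟩ := h.integral_eq f
  have hle : ∫ ω, ((symmDiff (C ω) (Chat ω)).card : ℝ) ∂μ ≤ ∫ ω, f (C ω) (G ω) ∂μ := by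
    refine integral_mono_of_nonneg (Eventually.of_forall fun ω => Nat.cast_nonneg _) hint ?_
    filter_upwards [hChat] with ω hω
    simp only [hf]
    split_ifs
    · rw [Nat.cast_le]
      exact (Finset.card_le_univ _).trans (by simp)
    · exact hω.card_symmDiff_le (C ω) _
  refine hle.trans ?_
  rw [heq, h.real_community (fun S => x ≤ |(S.card : ℝ) - K|), Finset.mul_sum]
  have hsum : 2 * (n * δ) + x = ∑ S, μ.real {ω | C ω = S} * (2 * (n * δ) + x) := by
    rw [← Finset.sum_mul, h.sum_real_community, one_mul]
  rw [hsum, ← Finset.sum_add_distrib]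
  refine Finset.sum_le_sum fun S _ => ?_
  rw [mul_left_comm (n : ℝ), ← mul_add]
  refine mul_le_mul_of_nonneg_left ?_ measureReal_nonneg
  by_cases hS : x ≤ |(S.card : ℝ) - K|
  · simp only [hf, if_pos hS, ← Finset.sum_mul, sum_graphProb]
    have : 0 ≤ 2 * (n * δ) + x := by positivity
    linarith
  · simp only [hf, if_neg hS, mul_zero, add_zero]
    push Not at hS
    have h1 : ∀ H : SimpleGraph (Fin n),
        graphProb p q S H * (2 * ((symmDiff S (aboveThreshold K p q r H)).card : ℝ) +
          |(S.card : ℝ) - K|) = 2 * (∑ i, graphProb p q S H *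
            (if i ∈ symmDiff S (aboveThreshold K p q r H) then 1 else 0)) +
          graphProb p q S H * |(S.card : ℝ) - K| := by
      intro H
      rw [← Finset.mul_sum, Finset.sum_boole, Finset.filter_mem_eq_inter, Finset.univ_inter]
      ring
    simp only [h1]
    rw [Finset.sum_add_distrib, ← Finset.mul_sum, ← Finset.sum_mul, sum_graphProb, one_mul,
      Finset.sum_comm]
    have h2 := Finset.sum_le_sum fun i (_ : i ∈ (Finset.univ : Finset (Fin n))) => hmis S hS i
    rw [Finset.sum_const, Finset.card_univ, Fintype.card_fin, nsmul_eq_mul] at h2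
    linarith

end Expectation

/-! ### Quantitative estimates on the scale z = n^(1/100) -/

section Regime

variable {n K r N : ℕ} {p q c lam z : ℝ} {S : Finset (Fin n)}

theorem half_le_scale (hq : 0 ≤ q) (hK2 : 2 * (K : ℝ) ≤ n) : n * q / 2 ≤ scale n K q := by
  rw [scale]
  nlinarith

theorem scale_le (hq : 0 ≤ q) (hqp : q ≤ p) : scale n K q ≤ n * p := by
  rw [scale]
  have h1 : 0 ≤ (K : ℝ) * q := mul_nonneg (Nat.cast_nonneg _) hq
  have h2 : (n : ℝ) * q ≤ n * p := mul_le_mul_of_nonneg_left hqp (Nat.cast_nonneg _)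
  linarith

theorem two_mul_sqrt_scale_le (hq : 0 ≤ q) (hqp : q ≤ p) (hp2 : 2 ≤ n * p) :
    2 * √(scale n K q) ≤ (n * p) ^ 2 := by
  have h1 : √(scale n K q) ≤ n * p := by
    refine Real.sqrt_le_iff.2 ⟨by linarith, (scale_le hq hqp).trans ?_⟩
    exact le_self_pow₀ (by linarith) (by norm_num)
  nlinarith

/-- A signal-to-noise ratio that stays away from zero forces large average degrees. -/
theorem sq_ratio_le_scale (hq : 0 < q) (hqp : q ≤ p) (hpq : p ≤ c * q) (hK : 0 < K)
    (hK2 : 2 * (K : ℝ) ≤ n) (hlam : snr n K p q = lam) :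
    lam * (n / K : ℝ) ^ 2 ≤ 4 * c ^ 2 * scale n K q := by
  have hK' : (0 : ℝ) < K := Nat.cast_pos.2 hK
  have hn : (0 : ℝ) < n := by linarith
  have hm := half_le_scale hq.le hK2
  have hnq : 0 < n * q := mul_pos hn hq
  have hm0 : 0 < scale n K q := by linarith
  have h1 : lam * scale n K q = K ^ 2 * (p - q) ^ 2 := by
    rw [← hlam, snr, ← scale, div_mul_cancel₀ _ hm0.ne']
  have h2 : (p - q) ^ 2 ≤ (c * q) ^ 2 := pow_le_pow_left₀ (by linarith) (by linarith) 2
  have h3 : (n * q) ^ 2 ≤ (2 * scale n K q) ^ 2 := pow_le_pow_left₀ hnq.le (by linarith) 2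
  have h4 : lam * (n : ℝ) ^ 2 * scale n K q ≤ 4 * c ^ 2 * K ^ 2 * scale n K q * scale n K q := by
    calc lam * (n : ℝ) ^ 2 * scale n K q = (n : ℝ) ^ 2 * (K ^ 2 * (p - q) ^ 2) := by
          rw [← h1]; ring
      _ ≤ (n : ℝ) ^ 2 * (K ^ 2 * (c * q) ^ 2) := by gcongr
      _ = c ^ 2 * K ^ 2 * (n * q) ^ 2 := by ring
      _ ≤ c ^ 2 * K ^ 2 * (2 * scale n K q) ^ 2 := by gcongr
      _ = _ := by ring
  have h5 := le_of_mul_le_mul_right h4 hm0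
  rw [div_pow, ← mul_div_assoc, div_le_iff₀ (by positivity)]
  linarith

theorem inv_pow_one_sub_le (h : (N : ℝ) ^ 2 * (r + 1) * p ≤ 1 / 2) (hp1 : p ≤ 1) :
    ((1 - p) ^ (N ^ 2))⁻¹ ^ (r + 1) ≤ 2 := by
  rw [inv_pow, ← pow_mul]
  have h1 := one_add_mul_le_pow (a := -p) (by linarith) (N ^ 2 * (r + 1))
  push_cast at h1
  rw [← sub_eq_add_neg] at h1
  have h2 : (1 : ℝ) / 2 ≤ (1 - p) ^ (N ^ 2 * (r + 1)) := by linarith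
  calc _ ≤ ((1 : ℝ) / 2)⁻¹ := inv_anti₀ (by norm_num) h2
    _ = 2 := by norm_num

theorem sum_range_pow_le {y : ℝ} (hy : 1 ≤ y) (T : ℕ) :
    ∑ t ∈ Finset.range (T + 1), y ^ t ≤ (T + 1) * y ^ T := by
  have := Finset.sum_le_card_nsmul (Finset.range (T + 1)) (fun t => y ^ t) (y ^ T)
    (fun t ht => pow_le_pow_right₀ hy (Nat.lt_succ_iff.1 (Finset.mem_range.1 ht)))
  simpa using this

/-- The probability that exploration fails is polynomially small. -/
theorem exploration_failure_le (hz : z ^ 100 = n) (hz4 : 4 ≤ z) (hp0 : 0 ≤ p) (hp2 : 1 ≤ n * p)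
    (hpz : n * p ≤ z) (hTz : (r : ℝ) + 1 ≤ z) (hT : (n * p) ^ (r + 1) ≤ z)
    (hN1 : (N : ℝ) ≤ z ^ 25) (hN2 : z ^ 25 / 2 ≤ N) :
    ((r + 1 : ℕ) : ℝ) * (N ^ 2 * p + n * N ^ 2 * p ^ 2) +
        (∑ t ∈ Finset.range (r + 2), (n * p) ^ t) / N ≤ 6 / z ^ 20 := by
  have hz0 : 0 < z := by linarith
  have hz1 : 1 ≤ z := by linarith
  have hp : p ≤ 1 / z ^ 99 := by
    rw [le_div_iff₀ (by positivity)]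
    have : p * z ^ 99 * z ≤ 1 * z := by rw [← hz] at hpz; linarith
    exact le_of_mul_le_mul_right this hz0
  have hN : (N : ℝ) ^ 2 * p ≤ 1 / z ^ 49 := by
    calc (N : ℝ) ^ 2 * p ≤ (z ^ 25) ^ 2 * (1 / z ^ 99) := by gcongr
      _ = 1 / z ^ 49 := by field_simp
  have h1 : ((r + 1 : ℕ) : ℝ) * (N ^ 2 * p + n * N ^ 2 * p ^ 2) ≤ 2 / z ^ 20 := by
    calc ((r + 1 : ℕ) : ℝ) * (N ^ 2 * p + n * N ^ 2 * p ^ 2)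
        = ((r : ℝ) + 1) * (N ^ 2 * p * (1 + n * p)) := by push_cast; ring
      _ ≤ z * (1 / z ^ 49 * (z + z)) := by gcongr
      _ = 2 / z ^ 47 := by field_simp; norm_num
      _ ≤ 2 / z ^ 20 := by gcongr; norm_num
  have h2 : (∑ t ∈ Finset.range (r + 2), (n * p) ^ t) / N ≤ 4 / z ^ 20 := by
    have h3 := sum_range_pow_le hp2 (r + 1)
    push_cast at h3
    calc (∑ t ∈ Finset.range (r + 2), (n * p) ^ t) / N ≤ ((z + z) * z) / (z ^ 25 / 2) := by
          refine div_le_div₀ (by positivity) (h3.trans ?_) (by positivity) hN2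
          gcongr
      _ = 4 / z ^ 23 := by field_simp; norm_num
      _ ≤ 4 / z ^ 20 := by gcongr; norm_num
  calc _ ≤ 2 / z ^ 20 + 4 / z ^ 20 := add_le_add h1 h2
    _ = 6 / z ^ 20 := by ring

/-- The one-step error is at most 2z^(-48), because p ≤ z^(-99) and the size deviation is at most
2z^51. Its amplification over all levels costs only z², since 2R ≤ y² and y^(2(r+1)) ≤ z. -/
theorem mean_error_bound {d B R y : ℝ} (hz4 : 4 ≤ z) (hp0 : 0 ≤ p) (hp : p ≤ 1 / z ^ 99)
    (hd0 : 0 ≤ d) (hd : d ≤ 2 * z ^ 51) (hR : 0 < R) (hB0 : 0 ≤ B) (hB : B ≤ R)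
    (hTz : (r : ℝ) + 1 ≤ z) (hRy : 2 * R ≤ y ^ 2) (hT : y ^ (2 * (r + 1)) ≤ z) :
    ((r + 1 : ℕ) : ℝ) * (2 * R) ^ (r + 1) * (p * d * B / R) ≤ 1 / z := by
  have hz0 : 0 < z := by linarith
  have hz1 : 1 ≤ z := by linarith
  have hBR : B / R ≤ 1 := (div_le_one hR).2 hB
  have hBR0 : 0 ≤ B / R := div_nonneg hB0 hR.le
  have h1 : p * d ≤ 1 / z ^ 99 * (2 * z ^ 51) := mul_le_mul hp hd hd0 (by positivity)
  have h2 : p * d * B / R ≤ 2 / z ^ 48 := by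
    calc p * d * B / R = p * d * (B / R) := by ring
      _ ≤ 1 / z ^ 99 * (2 * z ^ 51) * 1 := mul_le_mul h1 hBR hBR0 (by positivity)
      _ = 2 / z ^ 48 := by field_simp
  have h3 : (2 * R) ^ (r + 1) ≤ z := by
    refine le_trans ?_ hT
    rw [pow_mul]
    exact pow_le_pow_left₀ (by linarith) hRy _
  have h4 : ((r + 1 : ℕ) : ℝ) * (2 * R) ^ (r + 1) ≤ z * z := by
    push_cast
    exact mul_le_mul hTz h3 (pow_nonneg (by linarith) _) hz0.le
  have h5 : 0 ≤ p * d * B / R := by positivity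
  calc _ ≤ z * z * (2 / z ^ 48) := mul_le_mul h4 h2 h5 (by positivity)
    _ = 2 / z ^ 46 := by field_simp
    _ ≤ 1 / z := by
        rw [div_le_div_iff₀ (by positivity) hz0]
        calc 2 * z ≤ z * z := mul_le_mul_of_nonneg_right (by linarith) hz0.le
          _ = z ^ 2 := by ring
          _ ≤ 1 * z ^ 46 := by rw [one_mul]; exact pow_le_pow_right₀ hz1 (by norm_num)

/-- With x = n/K, the first three terms are O(1/x). The community term is P/m = O(1/x) times B² =
O(√x), and it alone decides the rate x^(-1/2). -/
theorem variance_increment_bound {x m B P : ℝ} (hc : 1 ≤ c) (hlam1 : 1 < lam) (hx1 : 1 ≤ x)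
    (hm0 : 0 < m) (hmx : lam * x ^ 2 ≤ 4 * c ^ 2 * m) (hP : P / m ≤ 4 * c / x)
    (hB : B ^ 2 ≤ lam * √x) :
    8 * (6 * c / x) + 6 * (1 / √x) ^ 2 + 384 / m + 3 * (P * B ^ 2 / m) ≤
      (48 * c + 6 + 1536 * c ^ 2 + 12 * c * lam) / √x := by
  have hx0 : 0 < x := by linarith
  have hsx1 : 1 ≤ √x := Real.one_le_sqrt.2 hx1
  have hsx0 : 0 < √x := by linarith
  have hsxx : √x * √x = x := Real.mul_self_sqrt hx0.le
  have hsxle : √x ≤ x := by nlinarith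
  have hinv : 1 / x ≤ 1 / √x := one_div_le_one_div_of_le hsx0 hsxle
  have t1 : 8 * (6 * c / x) ≤ 48 * c / √x := by
    calc 8 * (6 * c / x) = 48 * c * (1 / x) := by ring
      _ ≤ 48 * c * (1 / √x) := mul_le_mul_of_nonneg_left hinv (by linarith)
      _ = _ := by ring
  have t2 : 6 * (1 / √x) ^ 2 ≤ 6 / √x := by
    calc 6 * (1 / √x) ^ 2 = 6 * (1 / x) := by rw [div_pow, one_pow, pow_two, hsxx]
      _ ≤ 6 * (1 / √x) := mul_le_mul_of_nonneg_left hinv (by norm_num)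
      _ = _ := by ring
  have t3 : 384 / m ≤ 1536 * c ^ 2 / √x := by
    rw [div_le_div_iff₀ hm0 hsx0]
    have h1 : √x ≤ lam * x ^ 2 := by
      have : x * 1 ≤ x * x := mul_le_mul_of_nonneg_left hx1 hx0.le
      nlinarith
    linarith
  have t4 : 3 * (P * B ^ 2 / m) ≤ 12 * c * lam / √x := by
    calc 3 * (P * B ^ 2 / m) = 3 * (P / m * B ^ 2) := by ring
      _ ≤ 3 * (4 * c / x * (lam * √x)) := by
        refine mul_le_mul_of_nonneg_left (mul_le_mul hP hB (sq_nonneg _) ?_) (by norm_num)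
        exact div_nonneg (by linarith) hx0.le
      _ = 12 * c * lam * (√x / x) := by ring
      _ = 12 * c * lam / √x := by
        rw [Real.sqrt_div_self']
        ring
  calc _ ≤ 48 * c / √x + 6 / √x + 1536 * c ^ 2 / √x + 12 * c * lam / √x := by linarith
    _ = _ := by ring

theorem sqrt_deviation_le (hz : z ^ 100 = n) (hz1 : 1 ≤ z) (hKn : (K : ℝ) ≤ n)
    (hlog : Real.log n ≤ z) : √(3 * K * Real.log n) ≤ 2 * z ^ 51 := by
  refine Real.sqrt_le_iff.2 ⟨by positivity, ?_⟩
  rw [← hz] at hKn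
  calc 3 * K * Real.log n ≤ 3 * z ^ 100 * z := by gcongr
    _ ≤ 4 * z ^ 100 * z ^ 2 := by
      have : z ≤ z ^ 2 := le_self_pow₀ hz1 (by norm_num)
      gcongr; norm_num
    _ = _ := by ring

theorem pow_le_community (hz : z ^ 100 = n) (hz0 : 0 < z) (hK : 0 < K)
    (hxz : (n / K : ℝ) ≤ z) : z ^ 99 ≤ K := by
  have h1 : (n : ℝ) ≤ z * K := by rwa [div_le_iff₀ (Nat.cast_pos.2 hK)] at hxz
  have h2 : z * z ^ 99 ≤ z * K := by rw [← hz] at h1; linarith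
  exact le_of_mul_le_mul_left h2 hz0

/-- The probability that a vertex is misclassified, given a community of typical size. -/
theorem typical_misclassification_le (hq : 0 < q) (hqp : q ≤ p) (hpq : p ≤ c * q) (hc : 1 ≤ c)
    (hK : 0 < K) (hK2 : 2 * (K : ℝ) ≤ n) (hlam : snr n K p q = lam) (hlam1 : 1 < lam)
    (hz : z ^ 100 = n) (hz4 : 4 ≤ z) (hxz : (n / K : ℝ) ≤ z) (hx : 6 * c ≤ n / K)
    (hp2 : 2 ≤ n * p) (hpz : n * p ≤ z) (hT : (n * p) ^ (2 * (r + 1)) ≤ z)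
    (hlog : Real.log n ≤ z)
    (hB : meanInside n K p q (r + 1) ^ 2 ≤ lam * √(n / K))
    (hTβ : (r + 1) * ((48 * c + 6 + 1536 * c ^ 2 + 12 * c * lam) / √(n / K)) ≤ 2)
    (hsmall : meanInside n K p q (r + 1) + 9 ≤ √(scale n K q))
    (hS : |(S.card : ℝ) - K| < √(3 * K * Real.log n)) (i : Fin n) :
    ∑ H : SimpleGraph (Fin n), graphProb p q S H *
        (if i ∈ symmDiff S (aboveThreshold K p q r H) then 1 else 0) ≤
      2 * Real.exp (9 - meanInside n K p q (r + 1) / 2) + 6 / z ^ 20 := by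
  have hz0 : 0 < z := by linarith
  have hz1 : 1 ≤ z := by linarith
  have hp0 : 0 < p := by linarith
  have hK' : (0 : ℝ) < K := Nat.cast_pos.2 hK
  have hn : (0 : ℝ) < n := by linarith
  have hp : p ≤ 1 / z ^ 99 := by
    rw [le_div_iff₀ (by positivity)]
    have : p * z ^ 99 * z ≤ 1 * z := by rw [← hz] at hpz; linarith
    exact le_of_mul_le_mul_right this hz0
  have hp1 : p < 1 := by
    refine hp.trans_lt ?_
    rw [div_lt_one (by positivity)]
    exact one_lt_pow₀ (by linarith) (by norm_num)
  have hTpow : (n * p) ^ (r + 1) ≤ z :=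
    (pow_le_pow_right₀ (by linarith) (by omega)).trans hT
  have hTz : (r : ℝ) + 1 ≤ z := by
    have h1 : ((r + 1 : ℕ) : ℝ) ≤ 2 ^ (r + 1) := by
      exact_mod_cast (Nat.lt_two_pow_self (n := r + 1)).le
    push_cast at h1
    exact h1.trans ((pow_le_pow_left₀ (by norm_num) hp2 _).trans hTpow)
  have hzz : (4 : ℝ) ≤ z ^ 25 := hz4.trans (le_self_pow₀ hz1 (by norm_num))
  -- The exploration budget is about n^(1/4): large compared with (np)^T, yet small enough that N²p
  -- tends to zero.
  have hN1 : (⌊z ^ 25⌋₊ : ℝ) ≤ z ^ 25 := Nat.floor_le (by positivity)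
  have hN2 : z ^ 25 / 2 ≤ ⌊z ^ 25⌋₊ := by
    have := Nat.lt_floor_add_one (z ^ 25)
    linarith
  have hN0 : 0 < ⌊z ^ 25⌋₊ := Nat.floor_pos.2 (by linarith)
  set x : ℝ := n / K with hxdef
  set m := scale n K q with hmdef
  have hx1 : 1 ≤ x := by linarith
  have hx0 : 0 < x := by linarith
  have hsx1 : 1 ≤ √x := Real.one_le_sqrt.2 hx1
  have hsx0 : 0 < √x := by linarith
  have hsxx : √x * √x = x := Real.mul_self_sqrt hx0.le
  have hsxle : √x ≤ x := by nlinarith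
  have hlam0 : 0 < snr n K p q := by rw [hlam]; linarith
  have hBpos := meanInside_pos (n := n) (K := K) (p := p) (q := q) hlam0 (r + 1)
  set B := meanInside n K p q (r + 1) with hBdef
  have hm2 := half_le_scale (K := K) hq.le hK2
  have hm0 : 0 < m := lt_of_lt_of_le (by positivity) hm2
  have hRm : √m * √m = m := Real.mul_self_sqrt hm0.le
  have hR9 : 9 ≤ √m := by linarith
  have hm1 : 1 ≤ m := by nlinarith
  have hmx := sq_ratio_le_scale hq hqp hpq hK hK2 hlam
  rw [← hxdef, ← hmdef] at hmx
  have hsqrt := sqrt_deviation_le (K := K) hz hz1 (by linarith) hlog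
  have hKz := pow_le_community hz hz0 hK hxz
  have hkK : (S.card : ℝ) ≤ 2 * K := by
    have h1 := (abs_lt.1 hS).2
    have h2 : 2 * z ^ 51 ≤ z ^ 99 := by
      calc 2 * z ^ 51 ≤ z * z ^ 51 := by gcongr; linarith
        _ = z ^ 52 := by ring
        _ ≤ z ^ 99 := pow_le_pow_right₀ hz1 (by norm_num)
    linarith
  have hpKm : p * K / m ≤ 2 * c / x := by
    rw [div_le_div_iff₀ hm0 hx0, hxdef]
    have h1 : p * K * (n / K) = p * n := by field_simp
    rw [h1]
    calc p * n ≤ c * q * n := by gcongr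
      _ = 2 * c * (n * q / 2) := by ring
      _ ≤ 2 * c * m := by gcongr
  have hpSm : p * S.card / m ≤ 4 * c / x := by
    calc p * S.card / m ≤ p * (2 * K) / m := by gcongr
      _ = 2 * (p * K / m) := by ring
      _ ≤ 2 * (2 * c / x) := by gcongr
      _ = _ := by ring
  -- ρ = 6c/x comes from qn + p|S| ≤ m + 3pK and pK/m ≤ 2c/x. The error budget ε = x^(-1/2)
  -- dominates the available 1/z because √x ≤ x ≤ z.
  have hM := fun s => branchingMGF_beliefMean_le (S := S) (T := r + 1) (ρ := 6 * c / x)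
    (β := (48 * c + 6 + 1536 * c ^ 2 + 12 * c * lam) / √x) (J := p * |(S.card : ℝ) - K| * B / √m)
    (ε := 1 / √x) hq.le hqp hp1.le hm1 (by rw [hlam]; exact hlam1.le)
    (by rw [div_le_one hx0]; exact hx) ?_ le_rfl ?_ ?_ hsmall ?_ (by push_cast; exact hTβ) s i
  · refine (misclassification_le hq.le hqp hp1 hN0 r i hM).trans (add_le_add ?_ ?_)
    · refine mul_le_mul_of_nonneg_right (inv_pow_one_sub_le ?_ hp1.le) (Real.exp_pos _).le
      calc (⌊z ^ 25⌋₊ : ℝ) ^ 2 * (r + 1) * p ≤ (z ^ 25) ^ 2 * z * (1 / z ^ 99) := by gcongr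
        _ = 1 / z ^ 48 := by field_simp
        _ ≤ 1 / 2 := by
          gcongr
          exact le_trans (by linarith) (le_self_pow₀ hz1 (by norm_num))
    · exact exploration_failure_le hz hz4 hp0.le (by linarith) hpz hTz hTpow hN1 hN2
  · have h1 : p * K = p * K / m * m := (div_mul_cancel₀ _ hm0.ne').symm
    have h2 : p * S.card ≤ p * (2 * K) := by gcongr
    have h3 : q * n = m + q * K := by rw [hmdef, scale]; ring
    have h4 : q * K ≤ p * K := by gcongr
    have h5 : 6 * c / x = 3 * (2 * c / x) := by ring
    have h6 := mul_le_mul_of_nonneg_right hpKm hm0.le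
    rw [h5]
    linarith
  · refine (mean_error_bound hz4 hp0.le hp (abs_nonneg _) (hS.le.trans hsqrt) (by linarith)
      hBpos.le (by linarith) hTz (y := n * p) ?_ hT).trans ?_
    · exact two_mul_sqrt_scale_le hq.le hqp hp2
    · exact one_div_le_one_div_of_le hsx0 (hsxle.trans hxz)
  · rw [div_le_one hsx0]
    exact hsx1
  · exact variance_increment_bound hc hlam1 hx1 hm0 hmx hpSm hB

end Regime

/-! ### Number of iterations and the bound at fixed n -/

section Conclusion

variable {n K : ℕ} {p q c lam z : ℝ}

/-- The number of iterations is such that the mean `B_T` of the beliefs in the community is of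
order `(n / K) ^ (1 / 4)`. -/
theorem numIter_spec (hK : 0 < K) (hK2 : 3 * (K : ℝ) ≤ n) (hlam : snr n K p q = lam)
    (hlam1 : 1 < lam) :
    1 ≤ numIter n K p q ∧
      (numIter n K p q : ℝ) ≤ Real.log (n / K) / Real.log lam + 1 ∧
      meanInside n K p q (numIter n K p q) ^ 2 ≤ lam * √(n / K) ∧
      ((n / K : ℝ) / 2) ^ (1 / 4 : ℝ) ≤ meanInside n K p q (numIter n K p q) := by
  have hK' : (0 : ℝ) < K := Nat.cast_pos.2 hK
  have hlog : 0 < Real.log lam := Real.log_pos hlam1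
  have hlam0 : 0 < lam := by linarith
  set y : ℝ := ((n : ℝ) - K) / K with hy
  have hyx : y = n / K - 1 := by rw [hy, sub_div, div_self hK'.ne']
  have hx3 : (3 : ℝ) ≤ n / K := by rwa [le_div_iff₀ hK']
  have hy1 : 1 < y := by linarith
  have hy0 : 0 < y := by linarith
  have hL : 0 < Real.log y := Real.log_pos hy1
  have hLx : Real.log y ≤ Real.log (n / K) := Real.log_le_log hy0 (by linarith)
  have hT : numIter n K p q = ⌈2 * (1 / 4 : ℝ) * (Real.log y / Real.log lam)⌉₊ := by
    rw [numIter, hlam]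
  set T := numIter n K p q with hTdef
  have ha : 0 < 2 * (1 / 4 : ℝ) * (Real.log y / Real.log lam) := by positivity
  have hT1 : (T : ℝ) < 2 * (1 / 4 : ℝ) * (Real.log y / Real.log lam) + 1 := by
    rw [hT]; exact Nat.ceil_lt_add_one ha.le
  have hT2 : 2 * (1 / 4 : ℝ) * (Real.log y / Real.log lam) ≤ T := by
    rw [hT]; exact Nat.le_ceil _
  have hmul : 2 * (1 / 4 : ℝ) * (Real.log y / Real.log lam) * Real.log lam =
      Real.log y / 2 := by field_simp; norm_num
  have hT1' : T * Real.log lam ≤ Real.log y / 2 + Real.log lam := by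
    have := mul_le_mul_of_nonneg_right hT1.le hlog.le
    rw [add_mul, hmul, one_mul] at this
    exact this
  have hT2' : Real.log y / 2 ≤ T * Real.log lam := by
    have := mul_le_mul_of_nonneg_right hT2 hlog.le
    rwa [hmul] at this
  have hBexp : meanInside n K p q T = Real.exp (T * Real.log lam / 2) := by
    rw [meanInside, hlam, Real.rpow_def_of_pos hlam0]
    congr 1
    ring
  refine ⟨?_, ?_, ?_, ?_⟩
  · rw [hT]; exact Nat.one_le_ceil_iff.2 ha
  · have h1 : Real.log y / Real.log lam ≤ Real.log (n / K) / Real.log lam :=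
      div_le_div_of_nonneg_right hLx hlog.le
    have h2 : 0 < Real.log y / Real.log lam := by positivity
    linarith
  · rw [hBexp, ← Real.exp_nat_mul]
    calc _ ≤ Real.exp (Real.log (n / K) * (1 / 2) + Real.log lam) := by
          rw [Real.exp_le_exp]
          push_cast
          linarith
      _ = _ := by
          rw [Real.exp_add, Real.exp_log hlam0, Real.sqrt_eq_rpow,
            Real.rpow_def_of_pos (by linarith), mul_comm]
  · rw [hBexp]
    calc _ ≤ y ^ (1 / 4 : ℝ) := Real.rpow_le_rpow (by linarith) (by linarith) (by norm_num)
      _ = Real.exp (Real.log y * (1 / 4)) := Real.rpow_def_of_pos hy0 _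
      _ ≤ _ := by
          rw [Real.exp_le_exp]
          linarith

/-- √m grows at least like x/(2c), while B is at most λ√x. -/
theorem mean_add_le_sqrt_scale {B x m : ℝ} (hc : 1 ≤ c) (hlam1 : 1 < lam)
    (hmx : lam * x ^ 2 ≤ 4 * c ^ 2 * m) (hB : B ^ 2 ≤ lam * √x) (hx1 : 1 ≤ x)
    (hx : 2 * c * (lam + 9) ≤ √x) : B + 9 ≤ √m := by
  have hsx1 : 1 ≤ √x := Real.one_le_sqrt.2 hx1
  have hsxx : √x * √x = x := Real.mul_self_sqrt (by linarith)
  have hL : 1 ≤ lam * √x := by nlinarith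
  have hBL : B ≤ lam * √x := by nlinarith
  have h1 : 2 * c * (lam * √x + 9) ≤ x := by
    calc 2 * c * (lam * √x + 9) ≤ 2 * c * ((lam + 9) * √x) := by
          refine mul_le_mul_of_nonneg_left ?_ (by linarith)
          linarith
      _ = 2 * c * (lam + 9) * √x := by ring
      _ ≤ √x * √x := mul_le_mul_of_nonneg_right hx (by linarith)
      _ = x := hsxx
  have h2 : x / (2 * c) ≤ √m := by
    refine Real.le_sqrt_of_sq_le ?_
    rw [div_pow, div_le_iff₀ (by positivity)]
    nlinarith [sq_nonneg x]
  have h3 : lam * √x + 9 ≤ x / (2 * c) := by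
    rw [le_div_iff₀ (by linarith)]
    linarith
  linarith

/-- A bound on the expected error for fixed `n`. -/
theorem expected_error_le {Ω : Type*} [MeasurableSpace Ω] {μ : Measure Ω} [IsProbabilityMeasure μ]
    {C : Ω → Finset (Fin n)} {G : Ω → SimpleGraph (Fin n)} {Chat : Ω → Finset (Fin n)}
    (hq : 0 < q) (hqp : q ≤ p) (hpq : p ≤ c * q) (hc : 1 ≤ c)
    (hK : 0 < K) (hK2 : 3 * (K : ℝ) ≤ n) (hlam : snr n K p q = lam) (hlam1 : 1 < lam)
    (hz : z ^ 100 = n) (hz4 : 4 ≤ z) (hxz : (n / K : ℝ) ≤ z) (hx : 6 * c ≤ n / K)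
    (hp2 : 2 ≤ n * p) (hpz : n * p ≤ z)
    (hT : (n * p) ^ (2 * numIter n K p q) ≤ z) (hlog : Real.log n ≤ z)
    (hTβ : numIter n K p q * ((48 * c + 6 + 1536 * c ^ 2 + 12 * c * lam) / √(n / K)) ≤ 2)
    (hxlam : 2 * c * (lam + 9) ≤ √(n / K))
    (h : IsPlantedDenseSubgraph μ p q C G)
    (hChat : ∀ᵐ ω ∂μ, IsLMPOutput K p q (G ω) (Chat ω))
    (hsize : μ.real {ω | √(3 * K * Real.log n) ≤ |((C ω).card : ℝ) - K|} ≤ z / z ^ 50) :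
    ∫ ω, ((symmDiff (C ω) (Chat ω)).card : ℝ) ∂μ ≤
      K * (4 * (n / K * Real.exp (9 - ((n / K : ℝ) / 2) ^ (1 / 4 : ℝ) / 2)) + 15 / z) := by
  obtain ⟨hT1, -, hB2, hB⟩ := numIter_spec hK hK2 hlam hlam1
  -- T ≥ 1 makes the natural subtraction T - 1 exact: the beliefs θ^T are built from the messages
  -- θ^(T-1).
  obtain ⟨r, hr⟩ : ∃ r, numIter n K p q = r + 1 := ⟨numIter n K p q - 1, by omega⟩
  simp only [IsLMPOutput, hr, Nat.add_sub_cancel] at hChat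
  rw [hr] at hT hB hB2
  rw [hr] at hTβ
  push_cast at hTβ
  have hz0 : 0 < z := by linarith
  have hz1 : 1 ≤ z := by linarith
  have hK' : (0 : ℝ) < K := Nat.cast_pos.2 hK
  have hK2' : 2 * (K : ℝ) ≤ n := by linarith
  have hx0 : (0 : ℝ) ≤ n / K := by linarith
  have hnx : (n : ℝ) = K * (n / K) := (mul_div_cancel₀ _ hK'.ne').symm
  have hsmall := mean_add_le_sqrt_scale hc hlam1 (sq_ratio_le_scale hq hqp hpq hK hK2' hlam) hB2
    (by linarith) hxlam
  have hmain := integral_card_symmDiff_le (K := K) (r := r)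
    (δ := 2 * Real.exp (9 - meanInside n K p q (r + 1) / 2) + 6 / z ^ 20)
    (by positivity) (Real.sqrt_nonneg _) h hChat
    (fun S hS i => typical_misclassification_le hq hqp hpq hc hK hK2' hlam hlam1 hz hz4 hxz hx hp2
      hpz hT hlog hB2 hTβ hsmall hS i)
  refine hmain.trans ?_
  set x : ℝ := n / K with hxdef
  set D := Real.exp (9 - (x / 2) ^ (1 / 4 : ℝ) / 2) with hD
  have hDB : Real.exp (9 - meanInside n K p q (r + 1) / 2) ≤ D :=
    Real.exp_le_exp.2 (by linarith)
  have h1 : x * (6 / z ^ 20) ≤ 6 / z := by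
    calc x * (6 / z ^ 20) ≤ z * (6 / z ^ 20) := mul_le_mul_of_nonneg_right hxz (by positivity)
      _ = 6 / z ^ 19 := by field_simp
      _ ≤ 6 / z := div_le_div_of_nonneg_left (by norm_num) hz0
          (le_self_pow₀ hz1 (by norm_num))
  have h2 : √(3 * K * Real.log n) ≤ K * (2 / z) := by
    calc √(3 * K * Real.log n) ≤ 2 * z ^ 51 :=
          sqrt_deviation_le hz hz1 (by linarith) hlog
      _ ≤ 2 * z ^ 98 := mul_le_mul_of_nonneg_left
          (pow_le_pow_right₀ hz1 (by norm_num)) (by norm_num)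
      _ = z ^ 99 * (2 / z) := by field_simp
      _ ≤ K * (2 / z) := mul_le_mul_of_nonneg_right (pow_le_community hz hz0 hK hxz)
          (by positivity)
  have h3 : x * (z / z ^ 50) ≤ 1 / z := by
    calc x * (z / z ^ 50) ≤ z * (z / z ^ 50) := mul_le_mul_of_nonneg_right hxz (by positivity)
      _ = 1 / z ^ 48 := by field_simp
      _ ≤ 1 / z := div_le_div_of_nonneg_left (by norm_num) hz0
          (le_self_pow₀ hz1 (by norm_num))
  have h4 : (n : ℝ) * μ.real {ω | √(3 * K * Real.log n) ≤ |((C ω).card : ℝ) - K|} ≤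
      K * (1 / z) := by
    calc _ ≤ (n : ℝ) * (z / z ^ 50) := mul_le_mul_of_nonneg_left hsize (Nat.cast_nonneg _)
      _ = K * (x * (z / z ^ 50)) := by rw [hnx]; ring
      _ ≤ _ := mul_le_mul_of_nonneg_left h3 hK'.le
  have h5 : 2 * (n * (2 * Real.exp (9 - meanInside n K p q (r + 1) / 2) + 6 / z ^ 20)) ≤
      K * (4 * (x * D) + 12 / z) := by
    calc _ ≤ 2 * (n * (2 * D + 6 / z ^ 20)) := by gcongr
      _ = K * (4 * (x * D) + 2 * (x * (6 / z ^ 20))) := by rw [hnx]; ring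
      _ ≤ K * (4 * (x * D) + 2 * (6 / z)) := by gcongr
      _ = _ := by ring
  calc _ ≤ K * (4 * (x * D) + 12 / z) + K * (2 / z) + K * (1 / z) :=
        add_le_add (add_le_add h5 h2) h4
    _ = _ := by ring

theorem tendsto_mul_exp_neg_rpow :
    Tendsto (fun x : ℝ => x * Real.exp (9 - (x / 2) ^ (1 / 4 : ℝ) / 2)) atTop (𝓝 0) := by
  have h1 : Tendsto (fun x : ℝ => (x / 2) ^ (1 / 4 : ℝ) / 2) atTop atTop :=
    ((tendsto_rpow_atTop (by norm_num)).comp (tendsto_id.atTop_div_const (by norm_num))).atTop_div_const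
      (by norm_num)
  -- With u = (x/2)^(1/4)/2 one has x = 32u⁴, so the function is 32 e⁹ u⁴ e^(-u).
  have h2 := ((Real.tendsto_pow_mul_exp_neg_atTop_nhds_zero 4).comp h1).const_mul
    (32 * Real.exp 9)
  rw [mul_zero] at h2
  refine h2.congr' ?_
  filter_upwards [eventually_ge_atTop 0] with x hx
  have h3 : ((x / 2) ^ (1 / 4 : ℝ)) ^ 4 = x / 2 := by
    rw [← Real.rpow_natCast, ← Real.rpow_mul (by positivity)]
    norm_num
  simp only [Function.comp_apply]
  rw [div_pow, h3, sub_eq_add_neg, Real.exp_add]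
  ring

end Conclusion

/-! ### Passing from asymptotic hypotheses to eventual inequalities -/

section Asymptotics

/-- If `y ^ log x = n ^ o(1)`, then `y ^ (a log x)` is eventually at most any fixed power. -/
theorem eventually_rpow_log_le {x y : ℕ → ℝ} (hy : ∀ᶠ n in atTop, 1 ≤ y n) {ε : ℕ → ℝ}
    (hε : Tendsto ε atTop (𝓝 0))
    (h : ∀ᶠ n : ℕ in atTop, y n ^ Real.log (x n) = (n : ℝ) ^ ε n) (a : ℝ) {b : ℝ} (hb : 0 < b) :
    ∀ᶠ n : ℕ in atTop, y n ^ (a * Real.log (x n)) ≤ (n : ℝ) ^ b := by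
  have h1 : Tendsto (fun n => a * ε n) atTop (𝓝 0) := by simpa using hε.const_mul a
  filter_upwards [hy, h, h1.eventually (ge_mem_nhds hb), eventually_ge_atTop 1] with n hyn hn h1n hn1
  rw [mul_comm, Real.rpow_mul (by linarith), hn, ← Real.rpow_mul (Nat.cast_nonneg _), mul_comm]
  exact Real.rpow_le_rpow_of_exponent_le (by exact_mod_cast hn1) h1n

theorem tendsto_ratio_atTop {K : ℕ → ℕ} (hK : ∀ᶠ n in atTop, 0 < K n)
    (hKupper : (fun n => (K n : ℝ)) =o[atTop] (fun n => (n : ℝ))) :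
    Tendsto (fun n : ℕ => (n : ℝ) / K n) atTop atTop := by
  have h1 := hKupper.tendsto_div_nhds_zero
  have h2 : Tendsto (fun n : ℕ => (K n : ℝ) / n) atTop (𝓝[>] 0) := by
    refine tendsto_nhdsWithin_iff.2 ⟨h1, ?_⟩
    filter_upwards [hK, eventually_gt_atTop 0] with n hn hn0
    have hn' : (0 : ℝ) < K n := Nat.cast_pos.2 hn
    have hn0' : (0 : ℝ) < n := Nat.cast_pos.2 hn0
    exact div_pos hn' hn0'
  refine h2.inv_tendsto_nhdsGT_zero.congr fun n => ?_
  rw [Pi.inv_apply, inv_div]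

end Asymptotics

end PDS

end

theorem theorem4
    -- for every `n`: community size parameter and edge probabilities, `0 ≤ q ≤ p ≤ 1`
    (K : ℕ → ℕ) (p q : ℕ → ℝ) (lam : ℝ)
    (hq : ∀ n, 0 ≤ q n) (hqp : ∀ n, q n ≤ p n) (hp : ∀ n, p n ≤ 1)
    -- `p / q = O(1)`
    (hpq : (fun n => p n / q n) =O[atTop] (fun _ => (1 : ℝ)))
    -- `n ^ (1 - o(1)) ≤ K ≤ o(n)`
    (hKlower : ∃ ε : ℕ → ℝ, Tendsto ε atTop (𝓝 0) ∧
      ∀ᶠ n : ℕ in atTop, (n : ℝ) ^ (1 - ε n) ≤ (K n : ℝ))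
    (hKupper : (fun n => (K n : ℝ)) =o[atTop] (fun n => (n : ℝ)))
    -- `λ` is a constant greater than one
    (hlam : ∀ᶠ n : ℕ in atTop, PDS.snr n (K n) (p n) (q n) = lam) (hlam1 : 1 < lam)
    -- `(n p) ^ log (n / K) = n ^ o(1)`
    (hdeg : ∃ ε : ℕ → ℝ, Tendsto ε atTop (𝓝 0) ∧
      ∀ᶠ n : ℕ in atTop, ((n : ℝ) * p n) ^ Real.log ((n : ℝ) / K n) = (n : ℝ) ^ ε n)
    -- the planted dense subgraph models, with communities `C` and graphs `G`
    {Ω : ℕ → Type*} [∀ n, MeasurableSpace (Ω n)] (μ : ∀ n, Measure (Ω n))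
    [∀ n, IsProbabilityMeasure (μ n)]
    (C : ∀ n, Ω n → Finset (Fin n)) (G : ∀ n, Ω n → SimpleGraph (Fin n))
    (hmodel : ∀ n, PDS.IsPlantedDenseSubgraph (μ n) (p n) (q n) (C n) (G n))
    -- `P (||C| - K| ≥ √(3 K log n)) ≤ n ^ (-1/2 + o(1))`
    (hsize : ∃ ε : ℕ → ℝ, Tendsto ε atTop (𝓝 0) ∧
      ∀ᶠ n : ℕ in atTop,
        (μ n).real {ω | √(3 * K n * Real.log n) ≤ |((C n ω).card : ℝ) - K n|}
          ≤ (n : ℝ) ^ (-(1 / 2 : ℝ) + ε n))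
    -- the estimator `Chat` produced by the algorithm, with any rule for breaking ties
    (Chat : ∀ n, Ω n → Finset (Fin n))
    (hChat_meas : ∀ n, ∀ S : Finset (Fin n), MeasurableSet {ω | Chat n ω = S})
    (hChat : ∀ᶠ n : ℕ in atTop, ∀ᵐ ω ∂(μ n),
      PDS.IsLMPOutput (K n) (p n) (q n) (G n ω) (Chat n ω)) :
    -- `E |C △ Chat| = o(K)`
    (fun n => ∫ ω, ((symmDiff (C n ω) (Chat n ω)).card : ℝ) ∂(μ n))
      =o[atTop] (fun n => (K n : ℝ)) := by
  obtain ⟨ε₁, -, hKlow⟩ := hKlower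
  obtain ⟨ε₂, hε₂, hdeg⟩ := hdeg
  obtain ⟨ε₃, hε₃, hsize⟩ := hsize
  obtain ⟨c₀, hc₀⟩ := hpq.bound
  set c := max c₀ 1 with hcdef
  have hc : 1 ≤ c := le_max_right _ _
  have hlogl : 0 < Real.log lam := Real.log_pos hlam1
  have hK : ∀ᶠ n : ℕ in atTop, 0 < K n := by
    filter_upwards [hKlow, eventually_gt_atTop 0] with n hn hn0
    have : (0 : ℝ) < K n := (Real.rpow_pos_of_pos (Nat.cast_pos.2 hn0) _).trans_le hn
    exact_mod_cast this
  have hqpos : ∀ᶠ n : ℕ in atTop, 0 < q n := by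
    filter_upwards [hlam] with n hn
    refine lt_of_le_of_ne (hq n) fun h0 => ?_
    -- At q = 0 the ratio takes the default value 0 of division by zero, which contradicts λ > 1.
    rw [PDS.snr, ← h0, mul_zero, div_zero] at hn
    linarith
  have hpcq : ∀ᶠ n : ℕ in atTop, p n ≤ c * q n := by
    filter_upwards [hc₀, hqpos] with n hn hqn
    rw [norm_one, mul_one, Real.norm_eq_abs] at hn
    have h1 := (le_abs_self _).trans (hn.trans (le_max_left c₀ 1))
    rwa [div_le_iff₀ hqn] at h1
  have hx := PDS.tendsto_ratio_atTop hK hKupper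
  have hsx : Tendsto (fun n : ℕ => √((n : ℝ) / K n)) atTop atTop :=
    Real.tendsto_sqrt_atTop.comp hx
  have hlogx : Tendsto (fun n : ℕ => Real.log ((n : ℝ) / K n)) atTop atTop :=
    Real.tendsto_log_atTop.comp hx
  have hK3 : ∀ᶠ n : ℕ in atTop, 3 * (K n : ℝ) ≤ n := by
    filter_upwards [hK, hx.eventually_ge_atTop 3] with n hn h3
    rwa [le_div_iff₀ (Nat.cast_pos.2 hn)] at h3
  -- From λx² ≤ 4c²m ≤ 4c²np, the degree np is at least 3 once λx² ≥ 12c². The value 3 exceeds e,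
  -- which is used below to compare n/K with a power of np.
  have hY : ∀ᶠ n : ℕ in atTop, 3 ≤ n * p n := by
    filter_upwards [hK, hK3, hqpos, hpcq, hlam, hx.eventually_ge_atTop (12 * c ^ 2)] with
      n hn h3 hqn hpn hln hxn
    have h1 := PDS.sq_ratio_le_scale hqn (hqp n) hpn hn
      (by linarith [Nat.cast_nonneg (α := ℝ) (K n)]) hln
    have h2 := PDS.scale_le (n := n) (K := K n) hqn.le (hqp n)
    have h4 : 12 * c ^ 2 ≤ lam * ((n : ℝ) / K n) ^ 2 := by
      have hx1 : 1 ≤ (n : ℝ) / K n := by nlinarith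
      have h6 := le_self_pow₀ hx1 (two_ne_zero)
      have h7 : 1 * ((n : ℝ) / K n) ^ 2 ≤ lam * ((n : ℝ) / K n) ^ 2 :=
        mul_le_mul_of_nonneg_right hlam1.le (sq_nonneg _)
      linarith
    have h5 : 4 * c ^ 2 * 3 ≤ 4 * c ^ 2 * (n * p n) := by
      have := mul_le_mul_of_nonneg_left h2 (by positivity : 0 ≤ 4 * c ^ 2)
      linarith
    exact le_of_mul_le_mul_left h5 (by positivity)
  have hY1 : ∀ᶠ n : ℕ in atTop, 1 ≤ n * p n := hY.mono fun n hn => by linarith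
  -- Once log(n/K) ≥ 1, T ≤ log(n/K)/log λ + 1 ≤ a log(n/K). The exponent 2a below serves (np)^(2T).
  set a : ℝ := 1 / Real.log lam + 1 with hadef
  have ha0 : 0 ≤ 1 / Real.log lam := by positivity
  have hpow := PDS.eventually_rpow_log_le hY1 hε₂ hdeg (2 * a) (b := 1 / 100) (by norm_num)
  have hlogn := (isLittleO_log_rpow_atTop (r := 1 / 100) (by norm_num)).comp_tendsto
    tendsto_natCast_atTop_atTop
  have hlogn' : ∀ᶠ n : ℕ in atTop, Real.log n ≤ (n : ℝ) ^ (1 / 100 : ℝ) := by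
    filter_upwards [hlogn.bound (c := 1) (by norm_num)] with n hn
    simp only [Function.comp_apply, one_mul] at hn
    rw [Real.norm_of_nonneg (Real.rpow_nonneg (Nat.cast_nonneg _) _)] at hn
    exact (le_abs_self _).trans hn
  have hz : Tendsto (fun n : ℕ => (n : ℝ) ^ (1 / 100 : ℝ)) atTop atTop :=
    (tendsto_rpow_atTop (by norm_num)).comp tendsto_natCast_atTop_atTop
  have hlogdiv : Tendsto (fun n : ℕ => Real.log ((n : ℝ) / K n) / √((n : ℝ) / K n)) atTop (𝓝 0) := by
    have h1 := ((isLittleO_log_rpow_atTop (r := 1 / 2) (by norm_num)).tendsto_div_nhds_zero).comp hx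
    refine h1.congr fun n => ?_
    simp only [Function.comp_apply, Real.sqrt_eq_rpow]
  set D : ℝ := 48 * c + 6 + 1536 * c ^ 2 + 12 * c * lam with hD
  have hD0 : 0 ≤ D := by positivity
  have hTdiv : ∀ᶠ n : ℕ in atTop,
      a * D * (Real.log ((n : ℝ) / K n) / √((n : ℝ) / K n)) ≤ 2 := by
    have h1 := hlogdiv.const_mul (a * D)
    rw [mul_zero] at h1
    exact h1.eventually (ge_mem_nhds (by norm_num))
  have hbound : ∀ᶠ n : ℕ in atTop,
      ∫ ω, ((symmDiff (C n ω) (Chat n ω)).card : ℝ) ∂(μ n) ≤ K n *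
        (4 * ((n : ℝ) / K n * Real.exp (9 - (((n : ℝ) / K n) / 2) ^ (1 / 4 : ℝ) / 2)) +
          15 / (n : ℝ) ^ (1 / 100 : ℝ)) := by
    filter_upwards [hK, hK3, hqpos, hpcq, hlam, hY, hpow, hlogn', hz.eventually_ge_atTop 4, hTdiv,
      hx.eventually_ge_atTop (6 * c), hsx.eventually_ge_atTop (2 * c * (lam + 9)),
      hlogx.eventually_ge_atTop 1, hsize, hChat, hε₃.eventually (ge_mem_nhds (show (0 : ℝ) <
        1 / 100 by norm_num)), eventually_ge_atTop 1] with n hKn hK3n hqn hpn hln hYn hpown hlognn hzn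
      hTn hxc hsxn hlogxn hsizen hChatn hε₃n hn1
    have hn0 : (0 : ℝ) ≤ n := Nat.cast_nonneg _
    have hn1' : (1 : ℝ) ≤ n := by exact_mod_cast hn1
    have hY0 : (0 : ℝ) < n * p n := by linarith
    have hx0 : 0 < (n : ℝ) / K n := by linarith
    have hYexp : Real.exp 1 ≤ n * p n := Real.exp_one_lt_three.le.trans hYn
    obtain ⟨-, hTle, -, -⟩ := PDS.numIter_spec hKn hK3n hln hlam1
    have hTa : (PDS.numIter n (K n) (p n) (q n) : ℝ) ≤ a * Real.log ((n : ℝ) / K n) := by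
      rw [hadef, add_mul, one_mul, one_div_mul_eq_div]
      linarith
    have h2a : Real.log ((n : ℝ) / K n) ≤ 2 * a * Real.log ((n : ℝ) / K n) := by
      nlinarith
    have hexp : ∀ t : ℝ, t ≤ 2 * a * Real.log ((n : ℝ) / K n) →
        ((n : ℝ) * p n) ^ t ≤ (n : ℝ) ^ (1 / 100 : ℝ) := fun t ht =>
      (Real.rpow_le_rpow_of_exponent_le (by linarith) ht).trans hpown
    refine PDS.expected_error_le (c := c) (lam := lam) hqn (hqp n) hpn hc hKn hK3n hln hlam1 ?_ hzn
      ?_ hxc (by linarith) ?_ ?_ hlognn ?_ hsxn (hmodel n) hChatn ?_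
    · rw [← Real.rpow_natCast, ← Real.rpow_mul hn0]
      norm_num
    -- As np ≥ e, n/K = e^(log(n/K)) ≤ (np)^(log(n/K)), so the degree condition also bounds n/K by
    -- n^(1/100).
    · refine le_trans ?_ (hexp _ h2a)
      calc (n : ℝ) / K n = Real.exp 1 ^ Real.log ((n : ℝ) / K n) := by
            rw [← Real.exp_mul, one_mul, Real.exp_log hx0]
        _ ≤ _ := Real.rpow_le_rpow (Real.exp_pos 1).le hYexp (by linarith)
    · simpa using hexp 1 (hlogxn.trans h2a)
    · rw [← Real.rpow_natCast]
      refine hexp _ ?_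
      push_cast
      linarith
    · refine le_trans ?_ hTn
      calc _ ≤ a * Real.log ((n : ℝ) / K n) * (D / √((n : ℝ) / K n)) :=
            mul_le_mul_of_nonneg_right hTa (div_nonneg hD0 (Real.sqrt_nonneg _))
        _ = _ := by ring
    · refine hsizen.trans ?_
      -- On the scale z = n^(1/100), the bound z/z^50 is n^(-1/2) with a slack of n^(1/100) for the
      -- o(1) in the exponent.
      have h1 : (n : ℝ) ^ (1 / 100 : ℝ) / ((n : ℝ) ^ (1 / 100 : ℝ)) ^ 50 =
          (n : ℝ) ^ (-(1 / 2 : ℝ) + 1 / 100) := by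
        rw [← Real.rpow_natCast ((n : ℝ) ^ (1 / 100 : ℝ)), ← Real.rpow_mul hn0,
          ← Real.rpow_sub (by linarith)]
        norm_num
      rw [h1]
      exact Real.rpow_le_rpow_of_exponent_le hn1' (by linarith)
  have hlim : Tendsto (fun n : ℕ =>
      4 * ((n : ℝ) / K n * Real.exp (9 - (((n : ℝ) / K n) / 2) ^ (1 / 4 : ℝ) / 2)) +
        15 / (n : ℝ) ^ (1 / 100 : ℝ)) atTop (𝓝 0) := by
    have h1 := (PDS.tendsto_mul_exp_neg_rpow.comp hx).const_mul 4
    have h2 := hz.const_div_atTop 15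
    simpa using h1.add h2
  refine IsLittleO.of_bound fun b hb => ?_
  filter_upwards [hbound, hlim.eventually (ge_mem_nhds hb)] with n hn hbn
  rw [Real.norm_of_nonneg (integral_nonneg fun ω => Nat.cast_nonneg _),
    Real.norm_of_nonneg (Nat.cast_nonneg _), mul_comm b]
  exact hn.trans (mul_le_mul_of_nonneg_left hbn (Nat.cast_nonneg _))
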